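/- **Setting.** Let $\mathcal L$ be a signature with countably many individual constants, function symbols and predicate symbols, and let $\mathsf{Var}$ be a countably infinite set of individual variables. Formulas are built from atomic formulas $P\tau_1\cdots\tau_n$ and $\tau_1\approx\tau_2$ by $\wedge$, $\neg$, $\forall x$ and the temporal modalities $\mathbf G$ (always in the future) and $\mathbf H$ (always in the past); $\mathbf F=\neg\mathbf G\neg$, $\mathbf P=\neg\mathbf H\neg$, $\Box\varphi=\mathbf H\varphi\wedge\varphi\wedge\mathbf G\varphi$, and $\to,\vee$ are defined as usual. A sentence is a formula without free variables. *The logic.* $\mathrm L_{\mathbb R}$ is the smallest set of $\mathcal L$-formulas that is closed under modus ponens, $\varphi/\mathbf G\varphi$, $\varphi/\mathbf H\varphi$ and $\varphi/\forall x\varphi$, and contains all instances of truth-functional tautologies and of the following schemes: $\forall x\varphi\to\varphi(\tau/x)$ with $\tau$ free for $x$ in $\varphi$; $\forall x(\varphi\to\psi)\to(\forall x\varphi\to\forall x\psi)$; $\varphi\to\forall x\varphi$ with $x$ not free in $\varphi$; $\tau\approx\tau$; $\tau\approx\tau'\to(\varphi\to\varphi')$ with $\varphi$ atomic and $\varphi'$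 obtained from $\varphi$ by replacing some occurrences of $\tau$ by $\tau'$; $\tau\approx\tau'\to\Box(\tau\approx\tau')$; the schemes $\mathbf G(\varphi\to\psi)\to(\mathbf G\varphi\to\mathbf G\psi)$, $\varphi\to\mathbf G\mathbf P\varphi$, $\mathbf G\varphi\to\mathbf G\mathbf G\varphi$, $\mathbf F\varphi\wedge\mathbf F\psi\to\mathbf F(\varphi\wedge\psi)\vee\mathbf F(\varphi\wedge\mathbf F\psi)\vee\mathbf F(\mathbf F\varphi\wedge\psi)$, $\mathbf G\varphi\to\mathbf F\varphi$, $\mathbf G\mathbf G\varphi\to\mathbf G\varphi$ and their mirror images (exchanging $\mathbf G$ with $\mathbf H$ and $\mathbf F$ with $\mathbf P$); and $\Box(\mathbf G\varphi\to\mathbf P\mathbf G\varphi)\to(\mathbf G\varphi\to\mathbf H\varphi)$. A set $\Delta$ of formulas is $\mathrm L_{\mathbb R}$-consistent if $\neg\delta\notin\mathrm L_{\mathbb R}$ for every conjunction $\delta$ of finitely many members of $\Delta$; write $\Delta\vdash\varphi$ if $\delta\to\varphi\in\mathrm L_{\mathbb R}$ for some such $\delta$. $\Delta$ is $\mathrm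 L_{\mathbb R}$-saturated if it is maximal among $\mathrm L_{\mathbb R}$-consistent sets of formulas and, whenever $\Delta\vdash\varphi(\tau/x)$ for all closed terms $\tau$, also $\Delta\vdash\forall x\varphi$. A set of sentences is $\mathrm L_{\mathbb R}$-maximal if it is maximal among the $\mathrm L_{\mathbb R}$-consistent sets of sentences. *Admissible models.* Let $(T,<)$ be a linear order. A premodel over $(T,<)$ consists of a non-empty family $\mathit{Prop}$ of subsets of $T$ closed under the Boolean operations, under $[<]X=\{t:\forall s>t,\ s\in X\}$ and under $[>]X=\{t:\forall s<t,\ s\in X\}$; a set $U$; and interpretations of constants and function symbols as elements of and functions on $U$, and of $n$-ary predicate symbols as functions $U^n\to\wp(T)$. The truth set $|\varphi|^{\mathcal M}f\subseteq T$ of a formula under an assignment $f:\mathsf{Var}\to U$ is defined by the usual clauses for atomic formulas ($\approx$ is identity on $U$, at all times), $\wedge$ and $\neg$, by $[<]$ for $\mathbf G$ and $[>]$ for $\mathbf H$, and by $$|\forall x\varphi|^{\mathcal M}f=\bigcup\Big\{Y\in\mathit{Prop}: Y\subseteq\bigcap_{a\in U}|\varphi|^{\mathcal M}f[a/x]\Big\}.$$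 Write $\mathcal M,t,f\models\varphi$ for $t\in|\varphi|^{\mathcal M}f$, and $\mathcal M,t\models\varphi$, $|\varphi|^{\mathcal M}$ when $\varphi$ is a sentence. A premodel is an (admissible) model if $|\varphi|^{\mathcal M}f\in\mathit{Prop}$ for all $\varphi$ and $f$; it is a standard model if $\mathit{Prop}=\wp(T)$. **Theorem.** (1) (Strong completeness.) Every $\mathrm L_{\mathbb R}$-consistent set $\Delta$ of $\mathcal L$-formulas is satisfiable in an admissible $\mathcal L$-model over $(\mathbb R,<)$: there are such a model $\mathcal M$, a time $t\in\mathbb R$ and an assignment $f$ with $\mathcal M,t,f\models\varphi$ for all $\varphi\in\Delta$. (2) Let $\mathcal M$ be a standard $\mathcal L$-model over $(\mathbb Q,<)$ with universe $U$ that satisfies, at some $q_0\in\mathbb Q$ under some assignment $f_0$, all members of some $\mathrm L_{\mathbb R}$-saturated set of $\mathcal L$-formulas, and let each $a\in U$ be the value of a chosen closed term $\bar a$. Then one can assign to each $r\in\mathbb R$ a set $\Delta_r$ of sentences such that $\Delta_q=\{\varphi:\mathcal M,q\models\varphi\}$ for $q\in\mathbb Q$ and, for irrational $r$, $\Delta_r$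 is an $\mathrm L_{\mathbb R}$-maximal set of sentences that contains every sentence true in $\mathcal M$ at all rational points of some open interval around $r$. For every such family, all $\Delta_r$ are $\mathrm L_{\mathbb R}$-maximal, and with $|\varphi|_{\mathbb R}=\{r\in\mathbb R:\varphi\in\Delta_r\}$ there is a premodel $\mathcal M^*$ over $(\mathbb R,<)$ with universe $U$, with $\mathit{Prop}=\{|\varphi|_{\mathbb R}:\varphi\text{ a sentence}\}$, with the same interpretation of constants and function symbols as $\mathcal M$, and with $|P|^{\mathcal M^*}(a_1,\dots,a_n)=|P\bar a_1\cdots\bar a_n|_{\mathbb R}$. It has the following properties: - $|\varphi|^{\mathcal M^*}=|\varphi|_{\mathbb R}$ for every sentence $\varphi$; - $\mathcal M^*$ is an admissible model; - $\mathcal M^*,q\models\varphi$ iff $\mathcal M,q\models\varphi$, for every sentence $\varphi$ and $q\in\mathbb Q$; - $\mathcal M^*,q,f\models\varphi$ iff $\mathcal M,q,f\models\varphi$, for every formula $\varphi$, $q\in\mathbb Q$ and $f:\mathsf{Var}\to U$. -/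

import Mathlib

universe u v w

/-!  First-order temporal logic over a signature `L`, with individual variables indexed by `ℕ`.
Individual constants are the function symbols of arity `0`; terms are Mathlib's `L.Term ℕ`. -/

namespace TemporalLogic

/-- A term is closed if no variable occurs in it. -/
def ClosedTerm {L : FirstOrder.Language.{u, v}} (τ : L.Term ℕ) : Prop := τ.varFinset = ∅

/-- The term obtained from `t` by replacing every occurrence of the variable `x` by `τ`. -/
def substTerm {L : FirstOrder.Language.{u, v}} (x : ℕ) (τ t : L.Term ℕ) : L.Term ℕ :=
  t.subst (Function.update FirstOrder.Language.Term.var x τ)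

/-- Formulas of first-order temporal logic. -/
inductive Formula (L : FirstOrder.Language.{u, v}) : Type (max u v)
  | eq (τ₁ τ₂ : L.Term ℕ) : Formula L
  | rel {n : ℕ} (P : L.Relations n) (ts : Fin n → L.Term ℕ) : Formula L
  | and (φ ψ : Formula L) : Formula L
  | neg (φ : Formula L) : Formula L
  | all (x : ℕ) (φ : Formula L) : Formula L
  | G (φ : Formula L) : Formula L
  | H (φ : Formula L) : Formula L

namespace Formula

variable {L : FirstOrder.Language.{u, v}}

def or (φ ψ : Formula L) : Formula L := neg (and (neg φ) (neg ψ))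

def imp (φ ψ : Formula L) : Formula L := neg (and φ (neg ψ))

/-- "At some future time". -/
def F (φ : Formula L) : Formula L := neg (G (neg φ))

/-- "At some past time". -/
def P (φ : Formula L) : Formula L := neg (H (neg φ))

/-- "At all times": `Hφ ∧ φ ∧ Gφ`. -/
def box (φ : Formula L) : Formula L := and (H φ) (and φ (G φ))

/-- A fixed valid formula, serving as the empty conjunction. -/
def verum : Formula L := eq (.var 0) (.var 0)

/-- The conjunction of a finite list of formulas. -/
def conj : List (Formula L) → Formula L
  | [] => verum
  | φ :: l => and φ (conj l)

/-- The set of variables that occur free in a formula. -/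
def freeVars : Formula L → Finset ℕ
  | eq τ₁ τ₂ => τ₁.varFinset ∪ τ₂.varFinset
  | rel _ ts => Finset.univ.biUnion fun i => (ts i).varFinset
  | and φ ψ => φ.freeVars ∪ ψ.freeVars
  | neg φ => φ.freeVars
  | all x φ => φ.freeVars.erase x
  | G φ => φ.freeVars
  | H φ => φ.freeVars

/-- A sentence is a formula without free variables. -/
def IsSentence (φ : Formula L) : Prop := φ.freeVars = ∅

/-- `φ.subst x τ` is `φ(τ/x)`: all free occurrences of `x` are replaced by `τ`
(bound variables are not renamed). -/
def subst (x : ℕ) (τ : L.Term ℕ) : Formula L → Formula L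
  | eq τ₁ τ₂ => eq (substTerm x τ τ₁) (substTerm x τ τ₂)
  | rel R ts => rel R fun i => substTerm x τ (ts i)
  | and φ ψ => and (φ.subst x τ) (ψ.subst x τ)
  | neg φ => neg (φ.subst x τ)
  | all y φ => if y = x then all y φ else all y (φ.subst x τ)
  | G φ => G (φ.subst x τ)
  | H φ => H (φ.subst x τ)

/-- `τ` is free for `x` in a formula: no free occurrence of `x` lies in the scope of a
quantifier binding a variable of `τ`. -/
def FreeFor (x : ℕ) (τ : L.Term ℕ) : Formula L → Prop
  | eq _ _ => True
  | rel _ _ => True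
  | and φ ψ => φ.FreeFor x τ ∧ ψ.FreeFor x τ
  | neg φ => φ.FreeFor x τ
  | all y φ => x ∉ (all y φ).freeVars ∨ (y ∉ τ.varFinset ∧ φ.FreeFor x τ)
  | G φ => φ.FreeFor x τ
  | H φ => φ.FreeFor x τ

/-- Instances of truth-functional tautologies: formulas that are true under every two-valued
valuation of all formulas that respects negation and conjunction. -/
def IsTautology (φ : Formula L) : Prop :=
  ∀ V : Formula L → Prop,
    (∀ α, V (neg α) ↔ ¬ V α) → (∀ α β, V (and α β) ↔ (V α ∧ V β)) → V φ

end Formula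

open Formula

/-- `TermRepl τ τ' t t'`: the term `t'` results from `t` by replacing some occurrences of the
term `τ` by `τ'`. -/
inductive TermRepl {L : FirstOrder.Language.{u, v}} (τ τ' : L.Term ℕ) : L.Term ℕ → L.Term ℕ → Prop
  | keep (t : L.Term ℕ) : TermRepl τ τ' t t
  | replace : TermRepl τ τ' τ τ'
  | func {n : ℕ} (f : L.Functions n) (ts ts' : Fin n → L.Term ℕ)
      (h : ∀ i, TermRepl τ τ' (ts i) (ts' i)) : TermRepl τ τ' (.func f ts) (.func f ts')

/-- `AtomRepl τ τ' φ φ'`: `φ` is atomic and `φ'` results from `φ` by replacing some occurrences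
of the term `τ` by `τ'`. -/
inductive AtomRepl {L : FirstOrder.Language.{u, v}} (τ τ' : L.Term ℕ) : Formula L → Formula L → Prop
  | eq (s s' t t' : L.Term ℕ) (hs : TermRepl τ τ' s s') (ht : TermRepl τ τ' t t') :
      AtomRepl τ τ' (.eq s t) (.eq s' t')
  | rel {n : ℕ} (R : L.Relations n) (ts ts' : Fin n → L.Term ℕ)
      (h : ∀ i, TermRepl τ τ' (ts i) (ts' i)) : AtomRepl τ τ' (.rel R ts) (.rel R ts')

/-- The smallest temporal logic over `L` that contains all formulas in `Ax`. -/
inductive Derivable {L : FirstOrder.Language.{u, v}} (Ax : Set (Formula L)) : Formula L → Prop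
  | ax {φ : Formula L} (h : φ ∈ Ax) : Derivable Ax φ
  | modusPonens {φ ψ : Formula L} (h₁ : Derivable Ax φ) (h₂ : Derivable Ax (imp φ ψ)) :
      Derivable Ax ψ
  | genG {φ : Formula L} (h : Derivable Ax φ) : Derivable Ax (G φ)
  | genH {φ : Formula L} (h : Derivable Ax φ) : Derivable Ax (H φ)
  | genAll {φ : Formula L} (x : ℕ) (h : Derivable Ax φ) : Derivable Ax (all x φ)
  | tautology {φ : Formula L} (h : IsTautology φ) : Derivable Ax φ
  | instantiation (x : ℕ) (φ : Formula L) (τ : L.Term ℕ) (h : φ.FreeFor x τ) :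
      Derivable Ax (imp (all x φ) (φ.subst x τ))
  | distribution (x : ℕ) (φ ψ : Formula L) :
      Derivable Ax (imp (all x (imp φ ψ)) (imp (all x φ) (all x ψ)))
  | vacuous (x : ℕ) (φ : Formula L) (h : x ∉ φ.freeVars) : Derivable Ax (imp φ (all x φ))
  | selfIdentity (τ : L.Term ℕ) : Derivable Ax (.eq τ τ)
  | identicals (τ τ' : L.Term ℕ) (φ φ' : Formula L) (h : AtomRepl τ τ' φ φ') :
      Derivable Ax (imp (.eq τ τ') (imp φ φ'))
  | rigid (τ τ' : L.Term ℕ) : Derivable Ax (imp (.eq τ τ') (box (.eq τ τ')))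
  | distG (φ ψ : Formula L) : Derivable Ax (imp (G (imp φ ψ)) (imp (G φ) (G ψ)))
  | distH (φ ψ : Formula L) : Derivable Ax (imp (H (imp φ ψ)) (imp (H φ) (H ψ)))
  | convGP (φ : Formula L) : Derivable Ax (imp φ (G (P φ)))
  | convHF (φ : Formula L) : Derivable Ax (imp φ (H (F φ)))

/-- Bull's axioms for the rational time flow, each followed by its mirror image. -/
inductive RationalAxiom {L : FirstOrder.Language.{u, v}} : Formula L → Prop
  | transG (φ : Formula L) : RationalAxiom (imp (G φ) (G (G φ)))
  | transH (φ : Formula L) : RationalAxiom (imp (H φ) (H (H φ)))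
  | linearF (φ ψ : Formula L) : RationalAxiom
      (imp (and (F φ) (F ψ)) (or (or (F (and φ ψ)) (F (and φ (F ψ)))) (F (and (F φ) ψ))))
  | linearP (φ ψ : Formula L) : RationalAxiom
      (imp (and (P φ) (P ψ)) (or (or (P (and φ ψ)) (P (and φ (P ψ)))) (P (and (P φ) ψ))))
  | endlessG (φ : Formula L) : RationalAxiom (imp (G φ) (F φ))
  | endlessH (φ : Formula L) : RationalAxiom (imp (H φ) (P φ))
  | denseG (φ : Formula L) : RationalAxiom (imp (G (G φ)) (G φ))
  | denseH (φ : Formula L) : RationalAxiom (imp (H (H φ)) (H φ))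

/-- The Dedekind completeness axiom `□(Gφ → PGφ) → (Gφ → Hφ)`. -/
inductive DedekindAxiom {L : FirstOrder.Language.{u, v}} : Formula L → Prop
  | dedekind (φ : Formula L) :
      DedekindAxiom (imp (box (imp (G φ) (P (G φ)))) (imp (G φ) (H φ)))

/-- The logic `L_ℝ` over the signature `L`, as its set of theorems. -/
def LR (L : FirstOrder.Language.{u, v}) : Set (Formula L) :=
  {φ | Derivable {α | RationalAxiom α ∨ DedekindAxiom α} φ}

section Consistency

variable {L : FirstOrder.Language.{u, v}}

/-- A set of formulas is `Λ`-consistent if the negation of a conjunction of finitely many of its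
members is never a `Λ`-theorem. -/
def Consistent (Λ Δ : Set (Formula L)) : Prop :=
  ∀ l : List (Formula L), (∀ φ ∈ l, φ ∈ Δ) → neg (conj l) ∉ Λ

/-- Maximally `Λ`-consistent sets of formulas. -/
def MaxConsistent (Λ Δ : Set (Formula L)) : Prop :=
  Consistent Λ Δ ∧ ∀ Γ : Set (Formula L), Consistent Λ Γ → Δ ⊆ Γ → Γ = Δ

/-- `Δ ⊢_Λ φ`. -/
def Entails (Λ Δ : Set (Formula L)) (φ : Formula L) : Prop :=
  ∃ l : List (Formula L), (∀ ψ ∈ l, ψ ∈ Δ) ∧ imp (conj l) φ ∈ Λ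

/-- `∀`-completeness with respect to closed terms. -/
def ForallComplete (Λ Δ : Set (Formula L)) : Prop :=
  ∀ (φ : Formula L) (x : ℕ),
    (∀ τ : L.Term ℕ, ClosedTerm τ → Entails Λ Δ (φ.subst x τ)) → Entails Λ Δ (all x φ)

def Saturated (Λ Δ : Set (Formula L)) : Prop := MaxConsistent Λ Δ ∧ ForallComplete Λ Δ

/-- `Λ`-maximal sets of sentences: `Λ`-consistent sets of sentences that are not properly
included in any other. -/
def MaximalSentences (Λ Δ : Set (Formula L)) : Prop :=
  (∀ φ ∈ Δ, φ.IsSentence) ∧ Consistent Λ Δ ∧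
    ∀ Γ : Set (Formula L), (∀ φ ∈ Γ, φ.IsSentence) → Consistent Λ Γ → Δ ⊆ Γ → Γ = Δ

end Consistency

section Models

/-- The operation `[<]`. -/
def boxLT {T : Type*} [LinearOrder T] (X : Set T) : Set T := {t | ∀ s, t < s → s ∈ X}

/-- The operation `[>]`. -/
def boxGT {T : Type*} [LinearOrder T] (X : Set T) : Set T := {t | ∀ s, s < t → s ∈ X}

/-- A premodel for `L` with time flow `(T, <)` and universe `U`. The set `Adm` consists of the
admissible propositions. -/
structure Premodel (L : FirstOrder.Language.{u, v}) (T : Type*) [LinearOrder T] (U : Type*) where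
  Adm : Set (Set T)
  nonempty : Adm.Nonempty
  compl_mem : ∀ X ∈ Adm, Xᶜ ∈ Adm
  inter_mem : ∀ X ∈ Adm, ∀ Y ∈ Adm, X ∩ Y ∈ Adm
  boxLT_mem : ∀ X ∈ Adm, boxLT X ∈ Adm
  boxGT_mem : ∀ X ∈ Adm, boxGT X ∈ Adm
  funVal : ∀ {n : ℕ}, L.Functions n → (Fin n → U) → U
  relVal : ∀ {n : ℕ}, L.Relations n → (Fin n → U) → Set T

namespace Premodel

variable {L : FirstOrder.Language.{u, v}} {T : Type*} [LinearOrder T] {U : Type*}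

/-- The union of all admissible sets that are included in every member of `Z`. -/
def admInf (M : Premodel L T U) (Z : Set (Set T)) : Set T := ⋃₀ {Y | Y ∈ M.Adm ∧ Y ⊆ ⋂₀ Z}

/-- The value of a term under a variable assignment. -/
def termVal (M : Premodel L T U) (f : ℕ → U) : L.Term ℕ → U
  | .var x => f x
  | .func F ts => M.funVal F fun i => M.termVal f (ts i)

/-- The truth set of a formula under a variable assignment. -/
def truth (M : Premodel L T U) : Formula L → (ℕ → U) → Set T
  | .eq τ₁ τ₂, f => {_t | M.termVal f τ₁ = M.termVal f τ₂}
  | .rel R ts, f => M.relVal R fun i => M.termVal f (ts i)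
  | .and φ ψ, f => M.truth φ f ∩ M.truth ψ f
  | .neg φ, f => (M.truth φ f)ᶜ
  | .all x φ, f => M.admInf (Set.range fun a : U => M.truth φ (Function.update f x a))
  | .G φ, f => boxLT (M.truth φ f)
  | .H φ, f => boxGT (M.truth φ f)

/-- `M, t, f ⊨ φ`. -/
def Sat (M : Premodel L T U) (t : T) (f : ℕ → U) (φ : Formula L) : Prop := t ∈ M.truth φ f

/-- `M, t ⊨ φ`, that is, truth at `t` under all assignments; used for sentences, whose truth
does not depend on the assignment. -/
def TrueAt (M : Premodel L T U) (t : T) (φ : Formula L) : Prop := ∀ f : ℕ → U, M.Sat t f φ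

/-- A premodel is a model if every formula is admissible in it. -/
def IsModel (M : Premodel L T U) : Prop :=
  ∀ (φ : Formula L) (f : ℕ → U), M.truth φ f ∈ M.Adm

/-- A standard model: every set of times is admissible. -/
def IsStandard (M : Premodel L T U) : Prop := M.Adm = Set.univ

end Premodel

/-- The set of sentences that are true in `M` at all rational points of some open interval
around the real number `r`. -/
def localTheory {L : FirstOrder.Language.{u, v}} {U : Type*} (M : Premodel L ℚ U) (r : ℝ) :
    Set (Formula L) :=
  {φ | φ.IsSentence ∧
    ∃ s t : ℝ, s < r ∧ r < t ∧ ∀ q : ℚ, s < (q : ℝ) → (q : ℝ) < t → M.TrueAt q φ}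

/-- `D` assigns to every rational number the set of sentences true in `M` there, and to every
irrational number `r` an `L_ℝ`-maximal set of sentences extending `localTheory M r`. -/
def IsRealExtension {L : FirstOrder.Language.{u, v}} {U : Type*} (M : Premodel L ℚ U)
    (D : ℝ → Set (Formula L)) : Prop :=
  (∀ q : ℚ, D (q : ℝ) = {φ | φ.IsSentence ∧ M.TrueAt q φ}) ∧
    ∀ r : ℝ, Irrational r → MaximalSentences (LR L) (D r) ∧ localTheory M r ⊆ D r

/-- `N` is the premodel over `(ℝ, <)` determined by `M`, the family `D` of sets of sentences and
the choice `name a` of a term denoting `a`, for each `a` in the universe. -/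
structure IsRealCompletion {L : FirstOrder.Language.{u, v}} {U : Type*} (M : Premodel L ℚ U)
    (name : U → L.Term ℕ) (D : ℝ → Set (Formula L)) (N : Premodel L ℝ U) : Prop where
  adm : N.Adm = {X | ∃ φ : Formula L, φ.IsSentence ∧ X = {r | φ ∈ D r}}
  funVal : ∀ {n : ℕ} (F : L.Functions n) (a : Fin n → U), N.funVal F a = M.funVal F a
  relVal : ∀ {n : ℕ} (R : L.Relations n) (a : Fin n → U),
    N.relVal R a = {r | Formula.rel R (fun i => name (a i)) ∈ D r}

end Models

end TemporalLogic

/-!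
The theorem rests on a transfer from the rationals to the reals. Let `M` be a standard model over
`ℚ` that validates `L_ℝ`, and let `D r` be the theory of `M` at `r` for rational `r`, and a maximal
extension of the theory of `M` near `r` for irrational `r`. For a sentence `φ`, the set of rationals
at which `Gφ` is true is an upper segment of `ℚ`. It may define a cut at an irrational `r`, but then
`Gφ → PGφ` is true everywhere, and the Dedekind axiom says that `Gφ → Hφ` is true, so that `φ` is
true everywhere and there is no cut. Hence `Gφ ∈ D r` if and only if `φ ∈ D s` for all `s > r`
(`IsRealExtension.G_mem_iff`), and similarly for `H`. The sets `{r | φ ∈ D r}` are therefore closed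
under the operations of a premodel. In the truth lemma (`IsRealExtension.realPremodel_truth`) the
quantifier needs the admissible semantics: an admissible set below all instances of `∀xφ` is given
by a sentence `ψ`, and `ψ → ∀xφ` is true at all rationals because `M` is standard, hence it belongs
to every `D r`.

For strong completeness it remains to find a standard model over `ℚ`. Constants are added to the
signature, to name the free variables and to serve as witnesses; a consistent set of formulas then
becomes a consistent set of sentences that proves `∀xφ` whenever it proves all closed instances of
`φ` (`closedComplete_close`, by generalization on constants). This property survives the addition of
a sentence and, by the Barcan formula, the passage from `Γ` to `{φ | Gφ ∈ Γ}`; so, the language being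
countable, saturated sets exist in sufficient supply (`exists_saturatedSentences`,
`SaturatedSentences.exists_sees_not_mem`). The canonical frame of saturated sets is transitive,
without branching and without end points. It is also dense (`Sees.exists_between`): if `Γ` sees `Δ`
and `Δ` does not see itself, some sentence `Hχ ∧ ¬χ` in `Δ` pins `Δ` down as the only point after
`Γ` and comparable with `Δ` where it holds, and a point that witnesses `FF(Hχ ∧ ¬χ)` lies in
between. In such a frame finite chains can always be extended, so a generic sequence of finite
chains indexed by rationals yields a chain of type `ℚ` that realises every existential demand
(`exists_rat_chain`). Reading off the atomic facts along this chain gives the required model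
(`canonicalModel_truth`), and forgetting the added constants in the real model obtained from it does
not affect admissibility.
-/

namespace TemporalLogic

open Formula

variable {L : FirstOrder.Language.{u, v}}

/-! ### Propositional reasoning in `L_ℝ` -/

/-- Provability in `L_ℝ` from a set of formulas. -/
abbrev Proves (Γ : Set (Formula L)) (φ : Formula L) : Prop := Entails (LR L) Γ φ

infix:50 " ⊩ " => Proves

/-- Two-valued valuations of all formulas that respect negation and conjunction. -/
def IsValuation (V : Formula L → Prop) : Prop :=
  (∀ α, V (neg α) ↔ ¬ V α) ∧ ∀ α β, V (and α β) ↔ (V α ∧ V β)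

namespace IsValuation

variable {V : Formula L → Prop} (hV : IsValuation V)
include hV

theorem neg {α : Formula L} : V (.neg α) ↔ ¬ V α := hV.1 α

theorem and {α β : Formula L} : V (.and α β) ↔ V α ∧ V β := hV.2 α β

theorem imp {α β : Formula L} : V (.imp α β) ↔ (V α → V β) := by
  simp only [Formula.imp, hV.neg, hV.and]; tauto

theorem conj {l : List (Formula L)} : V (.conj l) ↔ (∀ φ ∈ l, V φ) ∧ V verum := by
  induction l with
  | nil => simp [Formula.conj]
  | cons a l ih => simp only [Formula.conj, hV.and, ih, List.forall_mem_cons]; tauto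

end IsValuation

theorem LR_mp {φ ψ : Formula L} (h : imp φ ψ ∈ LR L) (h' : φ ∈ LR L) : ψ ∈ LR L :=
  Derivable.modusPonens h' h

theorem LR_taut {φ : Formula L} (h : ∀ V, IsValuation V → V φ) : φ ∈ LR L :=
  Derivable.tautology fun V hn ha => h V ⟨hn, ha⟩

theorem verum_mem_LR : (verum : Formula L) ∈ LR L := Derivable.selfIdentity _

theorem Proves.of_LR {Γ : Set (Formula L)} {φ : Formula L} (h : φ ∈ LR L) : Γ ⊩ φ :=
  ⟨[], by simp, LR_mp (LR_taut fun V hV => by simp only [hV.imp]; tauto) h⟩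

theorem Proves.of_mem {Γ : Set (Formula L)} {φ : Formula L} (h : φ ∈ Γ) : Γ ⊩ φ :=
  ⟨[φ], by simpa using h, LR_taut fun V hV => by simp only [hV.imp, hV.conj]; simp; tauto⟩

theorem Proves.mp {Γ : Set (Formula L)} {φ ψ : Formula L} (h : Γ ⊩ imp φ ψ) (h' : Γ ⊩ φ) :
    Γ ⊩ ψ := by
  obtain ⟨l, hl, h⟩ := h
  obtain ⟨l', hl', h'⟩ := h'
  refine ⟨l ++ l', ?_, LR_mp (LR_mp (LR_taut fun V hV => ?_) h) h'⟩
  · intro χ hχ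
    rcases List.mem_append.1 hχ with h | h
    exacts [hl _ h, hl' _ h]
  · simp only [hV.imp, hV.conj, List.mem_append]
    intro h1 h2 h3
    exact h1 ⟨fun χ hχ => h3.1 χ (.inl hχ), h3.2⟩ (h2 ⟨fun χ hχ => h3.1 χ (.inr hχ), h3.2⟩)

theorem Proves.mono {Γ Γ' : Set (Formula L)} {φ : Formula L} (h : Γ ⊩ φ) (hs : Γ ⊆ Γ') :
    Γ' ⊩ φ := by
  obtain ⟨l, hl, h⟩ := h
  exact ⟨l, fun ψ hψ => hs (hl ψ hψ), h⟩

/-- Provability is closed under truth-functional consequence. -/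
theorem Proves.taut {Γ : Set (Formula L)} {φ : Formula L} (l : List (Formula L))
    (h : ∀ ψ ∈ l, Γ ⊩ ψ) (ht : ∀ V, IsValuation V → (∀ ψ ∈ l, V ψ) → V φ) : Γ ⊩ φ := by
  induction l generalizing φ with
  | nil => exact Proves.of_LR (LR_taut fun V hV => ht V hV (by simp))
  | cons a l ih =>
    refine Proves.mp (ih (φ := imp a φ) (fun ψ hψ => h ψ (by simp [hψ])) ?_) (h a (by simp))
    intro V hV hl
    rw [hV.imp]
    intro ha
    exact ht V hV (by simpa using ⟨ha, hl⟩)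

theorem Proves.taut₁ {Γ : Set (Formula L)} {φ α : Formula L} (h : Γ ⊩ α)
    (ht : ∀ V, IsValuation V → V α → V φ) : Γ ⊩ φ :=
  Proves.taut [α] (by simpa using h) (by simpa using ht)

theorem Proves.taut₂ {Γ : Set (Formula L)} {φ α β : Formula L} (h : Γ ⊩ α) (h' : Γ ⊩ β)
    (ht : ∀ V, IsValuation V → V α → V β → V φ) : Γ ⊩ φ :=
  Proves.taut [α, β] (by simpa using ⟨h, h'⟩) (by simpa using ht)

theorem proves_empty {φ : Formula L} : (∅ : Set (Formula L)) ⊩ φ ↔ φ ∈ LR L := by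
  refine ⟨?_, Proves.of_LR⟩
  rintro ⟨l, hl, h⟩
  obtain rfl : l = [] := List.eq_nil_iff_forall_not_mem.2 fun a ha => by simpa using hl a ha
  exact LR_mp h verum_mem_LR

theorem LR_taut₁ {φ α : Formula L} (h : α ∈ LR L)
    (ht : ∀ V, IsValuation V → V α → V φ) : φ ∈ LR L :=
  proves_empty.1 (Proves.taut₁ (proves_empty.2 h) ht)

theorem LR_taut₂ {φ α β : Formula L} (h : α ∈ LR L) (h' : β ∈ LR L)
    (ht : ∀ V, IsValuation V → V α → V β → V φ) : φ ∈ LR L :=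
  proves_empty.1 (Proves.taut₂ (proves_empty.2 h) (proves_empty.2 h') ht)

/-- The deduction theorem. -/
theorem proves_insert {Γ : Set (Formula L)} {α φ : Formula L} :
    insert α Γ ⊩ φ ↔ Γ ⊩ imp α φ := by
  constructor
  · rintro ⟨l, hl, h⟩
    have key : ∀ l : List (Formula L), (∀ ψ ∈ l, ψ ∈ insert α Γ) → Γ ⊩ imp α (conj l) := by
      intro l
      induction l with
      | nil =>
        intro _
        exact Proves.taut₁ (Proves.of_LR verum_mem_LR) fun V hV h => hV.imp.2 fun _ => h
      | cons a l ih =>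
        intro hl
        have ha : Γ ⊩ imp α a := by
          rcases hl a (by simp) with rfl | ha
          · exact Proves.of_LR (LR_taut fun V hV => hV.imp.2 id)
          · exact Proves.taut₁ (Proves.of_mem ha) fun V hV h => hV.imp.2 fun _ => h
        refine Proves.taut₂ ha (ih fun ψ hψ => hl ψ (by simp [hψ])) fun V hV => ?_
        simp only [conj, hV.imp, hV.and]; tauto
    refine Proves.taut₂ (key l hl) (Proves.of_LR h) fun V hV => ?_
    simp only [hV.imp]; tauto
  · intro h
    exact Proves.mp (h.mono (Set.subset_insert _ _)) (Proves.of_mem (Set.mem_insert _ _))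

theorem consistent_iff {Γ : Set (Formula L)} :
    Consistent (LR L) Γ ↔ ¬ Γ ⊩ neg verum := by
  constructor
  · rintro hc ⟨l, hl, h⟩
    refine hc l hl (LR_taut₂ h verum_mem_LR fun V hV => ?_)
    simp only [hV.imp, hV.neg]; tauto
  · intro hc l hl h
    refine hc ⟨l, hl, LR_taut₁ h fun V hV => ?_⟩
    simp only [hV.imp, hV.neg]; tauto

theorem consistent_insert {Γ : Set (Formula L)} {α : Formula L} :
    Consistent (LR L) (insert α Γ) ↔ ¬ Γ ⊩ neg α := by
  rw [consistent_iff, proves_insert, not_iff_not]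
  constructor <;> intro h
  · refine Proves.taut₂ h (Proves.of_LR verum_mem_LR) fun V hV => ?_
    simp only [hV.imp, hV.neg]; tauto
  · refine Proves.taut₁ h fun V hV => ?_
    simp only [hV.imp, hV.neg]; tauto

theorem Consistent.not_both {Γ : Set (Formula L)} (hc : Consistent (LR L) Γ) {α : Formula L}
    (h : Γ ⊩ α) (h' : Γ ⊩ neg α) : False := by
  refine consistent_iff.1 hc (Proves.taut₂ h h' fun V hV => ?_)
  simp only [hV.neg]; tauto

theorem MaxConsistent.LR_subset {Γ : Set (Formula L)} (h : MaxConsistent (LR L) Γ) :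
    LR L ⊆ Γ := by
  intro φ hφ
  have hc : Consistent (LR L) (insert φ Γ) :=
    consistent_insert.2 fun hn => h.1.not_both (Proves.of_LR hφ) hn
  rw [← h.2 _ hc (Set.subset_insert _ _)]
  exact Set.mem_insert _ _

/-! ### Maximal sets of sentences -/

@[simp] theorem isSentence_neg {φ : Formula L} : (neg φ).IsSentence ↔ φ.IsSentence := Iff.rfl

@[simp] theorem isSentence_G {φ : Formula L} : (G φ).IsSentence ↔ φ.IsSentence := Iff.rfl

@[simp] theorem isSentence_H {φ : Formula L} : (H φ).IsSentence ↔ φ.IsSentence := Iff.rfl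

@[simp] theorem isSentence_and {φ ψ : Formula L} :
    (and φ ψ).IsSentence ↔ φ.IsSentence ∧ ψ.IsSentence := Finset.union_eq_empty

@[simp] theorem isSentence_or {φ ψ : Formula L} :
    (or φ ψ).IsSentence ↔ φ.IsSentence ∧ ψ.IsSentence := isSentence_and

@[simp] theorem isSentence_imp {φ ψ : Formula L} :
    (imp φ ψ).IsSentence ↔ φ.IsSentence ∧ ψ.IsSentence := isSentence_and

@[simp] theorem isSentence_box {φ : Formula L} : (box φ).IsSentence ↔ φ.IsSentence := by
  simp [box]

/-- A consistent set of sentences that decides every sentence is maximal. -/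
theorem maximalSentences_of_complete {Γ : Set (Formula L)} (hs : ∀ φ ∈ Γ, φ.IsSentence)
    (hc : Consistent (LR L) Γ) (hd : ∀ φ : Formula L, φ.IsSentence → φ ∈ Γ ∨ neg φ ∈ Γ) :
    MaximalSentences (LR L) Γ := by
  refine ⟨hs, hc, fun Θ hΘ hcΘ hsub => (hsub.antisymm fun φ hφ => ?_).symm⟩
  rcases hd φ (hΘ φ hφ) with h | h
  · exact h
  · exact (hcΘ.not_both (Proves.of_mem hφ) (Proves.of_mem (hsub h))).elim

namespace MaximalSentences

variable {Γ : Set (Formula L)} (hΓ : MaximalSentences (LR L) Γ)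
include hΓ

theorem mem_of_proves {φ : Formula L} (hφ : φ.IsSentence) (h : Γ ⊩ φ) : φ ∈ Γ := by
  have hc : Consistent (LR L) (insert φ Γ) :=
    consistent_insert.2 fun hn => hΓ.2.1.not_both h hn
  rw [← hΓ.2.2 _ (by simpa using ⟨hφ, hΓ.1⟩) hc (Set.subset_insert _ _)]
  exact Set.mem_insert _ _

theorem mem_of_LR {φ : Formula L} (hφ : φ.IsSentence) (h : φ ∈ LR L) : φ ∈ Γ :=
  hΓ.mem_of_proves hφ (Proves.of_LR h)

theorem neg_mem {φ : Formula L} (hφ : φ.IsSentence) : neg φ ∈ Γ ↔ φ ∉ Γ := by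
  constructor
  · intro h h'
    exact hΓ.2.1.not_both (Proves.of_mem h') (Proves.of_mem h)
  · intro h
    by_contra hn
    have hc : Consistent (LR L) (insert φ Γ) :=
      consistent_insert.2 fun h' => hn (hΓ.mem_of_proves hφ h')
    refine h ?_
    rw [← hΓ.2.2 _ (by simpa using ⟨hφ, hΓ.1⟩) hc (Set.subset_insert _ _)]
    exact Set.mem_insert _ _

theorem and_mem {φ ψ : Formula L} : and φ ψ ∈ Γ ↔ φ ∈ Γ ∧ ψ ∈ Γ := by
  constructor
  · intro h
    have hs := isSentence_and.1 (hΓ.1 _ h)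
    exact ⟨hΓ.mem_of_proves hs.1 ((Proves.of_mem h).taut₁ fun V hV h => (hV.and.1 h).1),
      hΓ.mem_of_proves hs.2 ((Proves.of_mem h).taut₁ fun V hV h => (hV.and.1 h).2)⟩
  · rintro ⟨h, h'⟩
    exact hΓ.mem_of_proves (isSentence_and.2 ⟨hΓ.1 _ h, hΓ.1 _ h'⟩)
      ((Proves.of_mem h).taut₂ (Proves.of_mem h') fun V hV h h' => hV.and.2 ⟨h, h'⟩)

theorem imp_mem {φ ψ : Formula L} (hφ : φ.IsSentence) (hψ : ψ.IsSentence) :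
    imp φ ψ ∈ Γ ↔ (φ ∈ Γ → ψ ∈ Γ) := by
  rw [imp, hΓ.neg_mem (by simp [hφ, hψ]), hΓ.and_mem, hΓ.neg_mem hψ]; tauto

theorem or_mem {φ ψ : Formula L} (hφ : φ.IsSentence) (hψ : ψ.IsSentence) :
    or φ ψ ∈ Γ ↔ (φ ∈ Γ ∨ ψ ∈ Γ) := by
  rw [Formula.or, hΓ.neg_mem (by simp [hφ, hψ]), hΓ.and_mem, hΓ.neg_mem hφ, hΓ.neg_mem hψ]; tauto

theorem mp {φ ψ : Formula L} (hψ : ψ.IsSentence) (h : imp φ ψ ∈ LR L) (h' : φ ∈ Γ) : ψ ∈ Γ :=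
  hΓ.mem_of_proves hψ ((Proves.of_LR h).mp (Proves.of_mem h'))

theorem eq_of_subset {Θ : Set (Formula L)} (hΘ : MaximalSentences (LR L) Θ) (h : Γ ⊆ Θ) :
    Γ = Θ :=
  (hΓ.2.2 Θ hΘ.1 hΘ.2.1 h).symm

end MaximalSentences

/-- Lindenbaum's lemma for sets of sentences. -/
theorem exists_maximalSentences {Γ : Set (Formula L)} (hs : ∀ φ ∈ Γ, φ.IsSentence)
    (hc : Consistent (LR L) Γ) : ∃ Θ, MaximalSentences (LR L) Θ ∧ Γ ⊆ Θ := by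
  have H : ∀ C ⊆ {Θ : Set (Formula L) | (∀ φ ∈ Θ, φ.IsSentence) ∧ Consistent (LR L) Θ},
      IsChain (· ⊆ ·) C → C.Nonempty →
      ∃ Θ ∈ {Θ : Set (Formula L) | (∀ φ ∈ Θ, φ.IsSentence) ∧ Consistent (LR L) Θ},
        ∀ Θ' ∈ C, Θ' ⊆ Θ := by
    rintro C hC hchain ⟨Θ₀, hΘ₀⟩
    refine ⟨⋃₀ C, ⟨?_, ?_⟩, fun Θ hΘ => Set.subset_sUnion_of_mem hΘ⟩
    · rintro φ ⟨Θ, hΘ, hφ⟩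
      exact (hC hΘ).1 φ hφ
    · intro l hl
      have : ∃ Θ ∈ C, ∀ φ ∈ l, φ ∈ Θ := by
        induction l with
        | nil => exact ⟨Θ₀, hΘ₀, by simp⟩
        | cons a l ih =>
          obtain ⟨Θ, hΘ, h⟩ := ih fun φ hφ => hl φ (by simp [hφ])
          obtain ⟨Θ', hΘ', h'⟩ := hl a (by simp)
          rcases hchain.total hΘ hΘ' with hle | hle
          · exact ⟨Θ', hΘ', by simpa using ⟨h', fun φ hφ => hle (h φ hφ)⟩⟩
          · exact ⟨Θ, hΘ, by simpa using ⟨hle h', h⟩⟩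
      obtain ⟨Θ, hΘ, h⟩ := this
      exact (hC hΘ).2 l h
  obtain ⟨Θ, hsub, hmax⟩ := zorn_subset_nonempty _ H Γ ⟨hs, hc⟩
  exact ⟨Θ, ⟨hmax.prop.1, hmax.prop.2, fun Θ' h1 h2 h3 =>
    (hmax.eq_of_subset ⟨h1, h2⟩ h3).symm⟩, hsub⟩

/-! ### Substitution -/

theorem subst_congr {σ σ' : ℕ → L.Term ℕ} {t : L.Term ℕ} (h : ∀ x ∈ t.varFinset, σ x = σ' x) :
    t.subst σ = t.subst σ' := by
  induction t with
  | var x => exact h x (by simp)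
  | func F ts ih =>
    simp only [FirstOrder.Language.Term.subst]
    congr 1
    funext i
    exact ih i fun x hx => h x (by simpa using ⟨i, hx⟩)

@[simp] theorem subst_var (t : L.Term ℕ) : t.subst .var = t := by
  induction t with
  | var x => rfl
  | func F ts ih => simp only [FirstOrder.Language.Term.subst, ih]

theorem subst_subst (σ σ' : ℕ → L.Term ℕ) (t : L.Term ℕ) :
    (t.subst σ).subst σ' = t.subst fun x => (σ x).subst σ' := by
  induction t with
  | var x => rfl
  | func F ts ih => simp only [FirstOrder.Language.Term.subst, ih]

theorem mem_varFinset_subst {σ : ℕ → L.Term ℕ} {t : L.Term ℕ} {x : ℕ} :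
    x ∈ (t.subst σ).varFinset ↔ ∃ y ∈ t.varFinset, x ∈ (σ y).varFinset := by
  induction t with
  | var y => simp
  | func F ts ih =>
    simp only [FirstOrder.Language.Term.subst, FirstOrder.Language.Term.varFinset,
      Finset.mem_biUnion, Finset.mem_univ, true_and, ih]
    exact ⟨fun ⟨i, y, hy, h⟩ => ⟨y, ⟨i, hy⟩, h⟩, fun ⟨y, ⟨i, hy⟩, h⟩ => ⟨i, y, hy, h⟩⟩

theorem ClosedTerm.not_mem {τ : L.Term ℕ} (h : ClosedTerm τ) (x : ℕ) : x ∉ τ.varFinset := by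
  rw [h]; simp

theorem ClosedTerm.subst_eq {τ : L.Term ℕ} (h : ClosedTerm τ) (σ : ℕ → L.Term ℕ) :
    τ.subst σ = τ :=
  (subst_congr fun x hx => (h.not_mem x hx).elim).trans (subst_var τ)

theorem closedTerm_subst {σ : ℕ → L.Term ℕ} (hσ : ∀ x, ClosedTerm (σ x)) (t : L.Term ℕ) :
    ClosedTerm (t.subst σ) :=
  Finset.eq_empty_iff_forall_notMem.2 fun x hx =>
    let ⟨y, _, h⟩ := mem_varFinset_subst.1 hx
    (hσ y).not_mem x h

theorem not_closedTerm_var (x : ℕ) : ¬ ClosedTerm (.var x : L.Term ℕ) := by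
  simp [ClosedTerm]

theorem isSentence_eq {a b : L.Term ℕ} (ha : ClosedTerm a) (hb : ClosedTerm b) :
    (eq a b).IsSentence :=
  Finset.union_eq_empty.2 ⟨ha, hb⟩

theorem isSentence_rel {n : ℕ} {R : L.Relations n} {ts : Fin n → L.Term ℕ}
    (h : ∀ i, ClosedTerm (ts i)) : (rel R ts).IsSentence :=
  Finset.eq_empty_iff_forall_notMem.2 fun x hx =>
    let ⟨i, _, hi⟩ := Finset.mem_biUnion.1 hx
    (h i).not_mem x hi

/-- Simultaneous substitution of terms for the free variables of a formula. Bound variables are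
not renamed, so this is meaningful only for substitutions that cause no capture, such as those
satisfying `IsClosing`. -/
def Formula.msubst : (ℕ → L.Term ℕ) → Formula L → Formula L
  | σ, eq τ₁ τ₂ => eq (τ₁.subst σ) (τ₂.subst σ)
  | σ, rel R ts => rel R fun i => (ts i).subst σ
  | σ, and φ ψ => and (φ.msubst σ) (ψ.msubst σ)
  | σ, neg φ => neg (φ.msubst σ)
  | σ, all x φ => all x (φ.msubst (Function.update σ x (.var x)))
  | σ, G φ => G (φ.msubst σ)
  | σ, H φ => H (φ.msubst σ)

/-- A substitution that replaces some variables by closed terms and keeps the others. -/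
def IsClosing (σ : ℕ → L.Term ℕ) : Prop := ∀ x, σ x = .var x ∨ ClosedTerm (σ x)

theorem isClosing_var : IsClosing (.var : ℕ → L.Term ℕ) := fun _ => .inl rfl

theorem isClosing_of_closed {σ : ℕ → L.Term ℕ} (h : ∀ x, ClosedTerm (σ x)) : IsClosing σ :=
  fun x => .inr (h x)

theorem IsClosing.update {σ : ℕ → L.Term ℕ} (h : IsClosing σ) (x : ℕ) :
    IsClosing (Function.update σ x (.var x)) := by
  intro y
  by_cases hy : y = x
  · subst hy; simp
  · simpa [hy] using h y

theorem IsClosing.update_closed {σ : ℕ → L.Term ℕ} (h : IsClosing σ) (x : ℕ) {τ : L.Term ℕ}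
    (hτ : ClosedTerm τ) : IsClosing (Function.update σ x τ) := by
  intro y
  by_cases hy : y = x
  · subst hy; simp [hτ]
  · simpa [hy] using h y

theorem msubst_congr {φ : Formula L} {σ σ' : ℕ → L.Term ℕ} (h : ∀ x ∈ φ.freeVars, σ x = σ' x) :
    φ.msubst σ = φ.msubst σ' := by
  induction φ generalizing σ σ' with
  | eq a b =>
    simp only [msubst]
    rw [subst_congr fun x hx => h x (Finset.mem_union_left _ hx),
      subst_congr fun x hx => h x (Finset.mem_union_right _ hx)]
  | rel R ts =>
    simp only [msubst]
    congr 1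
    funext i
    exact subst_congr fun x hx => h x (Finset.mem_biUnion.2 ⟨i, Finset.mem_univ i, hx⟩)
  | and φ ψ ih ih' =>
    simp only [msubst]
    rw [ih fun x hx => h x (Finset.mem_union_left _ hx),
      ih' fun x hx => h x (Finset.mem_union_right _ hx)]
  | neg φ ih | G φ ih | H φ ih => simp only [msubst]; rw [ih h]
  | all y φ ih =>
    simp only [msubst]
    rw [ih]
    intro x hx
    by_cases hxy : x = y
    · subst hxy; simp
    · simpa [hxy] using h x (Finset.mem_erase.2 ⟨hxy, hx⟩)

@[simp] theorem msubst_var (φ : Formula L) : φ.msubst .var = φ := by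
  induction φ with
  | eq | rel => simp [msubst]
  | all x φ ih => simp [msubst, ih]
  | and φ ψ ih ih' => simp [msubst, ih, ih']
  | neg φ ih | G φ ih | H φ ih => simp [msubst, ih]

theorem msubst_sentence {φ : Formula L} (h : φ.IsSentence) (σ : ℕ → L.Term ℕ) :
    φ.msubst σ = φ :=
  (msubst_congr fun x hx => by rw [h] at hx; simp at hx).trans (msubst_var φ)

/-- A closing substitution that keeps `x`, followed by the substitution of `τ` for `x`. -/
theorem subst_msubst {σ : ℕ → L.Term ℕ} (hσ : IsClosing σ) {x : ℕ} (hx : σ x = .var x)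
    (τ : L.Term ℕ) (φ : Formula L) :
    (φ.msubst σ).subst x τ = φ.msubst (Function.update σ x τ) := by
  have key : ∀ {σ : ℕ → L.Term ℕ}, IsClosing σ → σ x = .var x → ∀ t : L.Term ℕ,
      substTerm x τ (t.subst σ) = t.subst (Function.update σ x τ) := by
    intro σ hσ hx t
    rw [substTerm, subst_subst]
    congr 1
    funext y
    by_cases hy : y = x
    · subst hy; simp [hx]
    · rcases hσ y with h | h
      · simp [h, hy]
      · simp [hy, h.subst_eq]
  induction φ generalizing σ with
  | eq a b => simp only [msubst, Formula.subst, key hσ hx]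
  | rel R ts => simp only [msubst, Formula.subst, key hσ hx]
  | and φ ψ ih ih' => simp only [msubst, Formula.subst, ih hσ hx, ih' hσ hx]
  | neg φ ih | G φ ih | H φ ih => simp only [msubst, Formula.subst, ih hσ hx]
  | all y φ ih =>
    simp only [msubst, Formula.subst]
    by_cases hy : y = x
    · subst hy; simp
    · rw [if_neg hy, ih (hσ.update y) (by simp [Ne.symm hy, hx]), Function.update_comm hy]

theorem subst_eq_msubst (x : ℕ) (τ : L.Term ℕ) (φ : Formula L) :
    φ.subst x τ = φ.msubst (Function.update .var x τ) := by
  simpa using subst_msubst isClosing_var rfl τ φ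

theorem msubst_update_subst {σ : ℕ → L.Term ℕ} (hσ : IsClosing σ) (x : ℕ) (τ : L.Term ℕ)
    (φ : Formula L) :
    (φ.msubst (Function.update σ x (.var x))).subst x τ = φ.msubst (Function.update σ x τ) := by
  rw [subst_msubst (hσ.update x) (by simp), Function.update_idem]

theorem mem_freeVars_msubst {σ : ℕ → L.Term ℕ} (hσ : IsClosing σ) {φ : Formula L} {x : ℕ}
    (h : x ∈ (φ.msubst σ).freeVars) : x ∈ φ.freeVars ∧ σ x = .var x := by
  have key : ∀ {σ : ℕ → L.Term ℕ}, IsClosing σ → ∀ t : L.Term ℕ, x ∈ (t.subst σ).varFinset →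
      x ∈ t.varFinset ∧ σ x = .var x := by
    intro σ hσ t h
    obtain ⟨y, hy, h⟩ := mem_varFinset_subst.1 h
    rcases hσ y with h' | h'
    · rw [h'] at h
      obtain rfl : x = y := by simpa using h
      exact ⟨hy, h'⟩
    · exact (h'.not_mem x h).elim
  induction φ generalizing σ with
  | eq a b =>
    rcases Finset.mem_union.1 h with h | h
    · exact ⟨Finset.mem_union_left _ (key hσ _ h).1, (key hσ _ h).2⟩
    · exact ⟨Finset.mem_union_right _ (key hσ _ h).1, (key hσ _ h).2⟩
  | rel R ts =>
    obtain ⟨i, hi, h⟩ := Finset.mem_biUnion.1 h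
    exact ⟨Finset.mem_biUnion.2 ⟨i, hi, (key hσ _ h).1⟩, (key hσ _ h).2⟩
  | and φ ψ ih ih' =>
    rcases Finset.mem_union.1 h with h | h
    · exact ⟨Finset.mem_union_left _ (ih hσ h).1, (ih hσ h).2⟩
    · exact ⟨Finset.mem_union_right _ (ih' hσ h).1, (ih' hσ h).2⟩
  | neg φ ih | G φ ih | H φ ih => exact ih hσ h
  | all y φ ih =>
    obtain ⟨hxy, h⟩ := Finset.mem_erase.1 h
    obtain ⟨h1, h2⟩ := ih (hσ.update y) h
    exact ⟨Finset.mem_erase.2 ⟨hxy, h1⟩, by simpa [hxy] using h2⟩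

theorem isSentence_msubst {σ : ℕ → L.Term ℕ} (hσ : ∀ x, ClosedTerm (σ x)) (φ : Formula L) :
    (φ.msubst σ).IsSentence :=
  Finset.eq_empty_iff_forall_notMem.2 fun x hx => not_closedTerm_var (L := L) x
    ((mem_freeVars_msubst (isClosing_of_closed hσ) hx).2 ▸ hσ x)

theorem isSentence_all_msubst {σ : ℕ → L.Term ℕ} (hσ : ∀ x, ClosedTerm (σ x)) (x : ℕ)
    (φ : Formula L) : (all x (φ.msubst (Function.update σ x (.var x)))).IsSentence :=
  isSentence_msubst hσ (all x φ)

theorem isSentence_subst {x : ℕ} {φ : Formula L} (h : (all x φ).IsSentence) {τ : L.Term ℕ}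
    (hτ : ClosedTerm τ) : (φ.subst x τ).IsSentence := by
  refine Finset.eq_empty_iff_forall_notMem.2 fun y hy => ?_
  rw [subst_eq_msubst] at hy
  obtain ⟨h1, h2⟩ := mem_freeVars_msubst (isClosing_var.update_closed x hτ) hy
  by_cases hyx : y = x
  · subst hyx
    rw [Function.update_self] at h2
    exact not_closedTerm_var (L := L) y (h2 ▸ hτ)
  · have : y ∈ (all x φ).freeVars := Finset.mem_erase.2 ⟨hyx, h1⟩
    rw [h] at this
    simp at this

theorem subst_of_not_free {x : ℕ} {φ : Formula L} (h : x ∉ φ.freeVars) (τ : L.Term ℕ) :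
    φ.subst x τ = φ := by
  rw [subst_eq_msubst]
  refine (msubst_congr fun y hy => ?_).trans (msubst_var φ)
  have : y ≠ x := fun e => h (e ▸ hy)
  simp [this]

theorem freeFor_of_closed (x : ℕ) {τ : L.Term ℕ} (hτ : ClosedTerm τ) (φ : Formula L) :
    φ.FreeFor x τ := by
  induction φ with
  | eq | rel => trivial
  | and φ ψ ih ih' => exact ⟨ih, ih'⟩
  | neg φ ih | G φ ih | H φ ih => exact ih
  | all y φ ih => exact .inr ⟨hτ.not_mem y, ih⟩

theorem freeFor_of_not_free {x : ℕ} {φ : Formula L} (h : x ∉ φ.freeVars) (τ : L.Term ℕ) :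
    φ.FreeFor x τ := by
  induction φ with
  | eq | rel => trivial
  | and φ ψ ih ih' =>
    exact ⟨ih fun hx => h (Finset.mem_union_left _ hx),
      ih' fun hx => h (Finset.mem_union_right _ hx)⟩
  | neg φ ih | G φ ih | H φ ih => exact ih h
  | all y φ ih => exact .inl h

theorem freeFor_self (x : ℕ) (φ : Formula L) : φ.FreeFor x (.var x) := by
  induction φ with
  | eq | rel => trivial
  | and φ ψ ih ih' => exact ⟨ih, ih'⟩
  | neg φ ih | G φ ih | H φ ih => exact ih
  | all y φ ih =>
    by_cases hy : y = x
    · subst hy; exact .inl (Finset.notMem_erase _ _)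
    · exact .inr ⟨by simpa using hy, ih⟩

@[simp] theorem subst_self (x : ℕ) (φ : Formula L) : φ.subst x (.var x) = φ := by
  rw [subst_eq_msubst, Function.update_eq_self]; exact msubst_var φ

theorem LR_inst {x : ℕ} {φ : Formula L} (h : all x φ ∈ LR L) : φ ∈ LR L := by
  have := Derivable.instantiation (Ax := {α | RationalAxiom α ∨ DedekindAxiom α}) x φ (.var x)
    (freeFor_self x φ)
  rw [subst_self] at this
  exact LR_mp this h

theorem LR_all_imp_subst (x : ℕ) (φ : Formula L) {τ : L.Term ℕ} (hτ : ClosedTerm τ) :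
    imp (all x φ) (φ.subst x τ) ∈ LR L :=
  Derivable.instantiation x φ τ (freeFor_of_closed x hτ φ)

/-- The quantification of a formula over all variables below a bound. -/
def Formula.allBelow : ℕ → Formula L → Formula L
  | 0, φ => φ
  | n + 1, φ => all n (φ.allBelow n)

theorem allBelow_mem_LR {φ : Formula L} (h : φ ∈ LR L) (n : ℕ) : φ.allBelow n ∈ LR L := by
  induction n with
  | zero => exact h
  | succ n ih => exact Derivable.genAll n ih

theorem freeVars_allBelow (n : ℕ) (φ : Formula L) :
    (φ.allBelow n).freeVars = φ.freeVars.filter (n ≤ ·) := by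
  induction n with
  | zero => simp [allBelow]
  | succ n ih =>
    ext x
    simp only [allBelow, freeVars, ih, Finset.mem_erase, Finset.mem_filter]
    grind

/-- Every formula has a universal closure. -/
theorem exists_allBelow_isSentence (φ : Formula L) : ∃ n, (φ.allBelow n).IsSentence := by
  refine ⟨φ.freeVars.sup id + 1, ?_⟩
  rw [IsSentence, freeVars_allBelow, Finset.filter_eq_empty_iff]
  intro x hx h
  have := Finset.le_sup (f := id) hx
  simp only [id] at this
  omega

/-! ### Truth sets -/

namespace Premodel

variable {T : Type*} [LinearOrder T] {U : Type*} (M : Premodel L T U)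

theorem termVal_congr {f g : ℕ → U} {t : L.Term ℕ} (h : ∀ x ∈ t.varFinset, f x = g x) :
    M.termVal f t = M.termVal g t := by
  induction t with
  | var x => exact h x (by simp)
  | func F ts ih =>
    simp only [termVal]
    congr 1
    funext i
    exact ih i fun x hx => h x (by simpa using ⟨i, hx⟩)

theorem truth_congr {φ : Formula L} {f g : ℕ → U} (h : ∀ x ∈ φ.freeVars, f x = g x) :
    M.truth φ f = M.truth φ g := by
  induction φ generalizing f g with
  | eq a b =>
    simp only [truth]
    rw [M.termVal_congr fun x hx => h x (Finset.mem_union_left _ hx),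
      M.termVal_congr fun x hx => h x (Finset.mem_union_right _ hx)]
  | rel R ts =>
    simp only [truth]
    congr 1
    funext i
    exact M.termVal_congr fun x hx => h x (Finset.mem_biUnion.2 ⟨i, Finset.mem_univ i, hx⟩)
  | and φ ψ ih ih' =>
    simp only [truth]
    rw [ih fun x hx => h x (Finset.mem_union_left _ hx),
      ih' fun x hx => h x (Finset.mem_union_right _ hx)]
  | neg φ ih | G φ ih | H φ ih => simp only [truth]; rw [ih h]
  | all y φ ih =>
    simp only [truth]
    congr 2
    funext a
    refine ih fun x hx => ?_
    by_cases hxy : x = y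
    · subst hxy; simp
    · simpa [hxy] using h x (Finset.mem_erase.2 ⟨hxy, hx⟩)

theorem truth_sentence {φ : Formula L} (h : φ.IsSentence) (f g : ℕ → U) :
    M.truth φ f = M.truth φ g :=
  M.truth_congr fun x hx => by rw [h] at hx; simp at hx

theorem trueAt_iff_sat {φ : Formula L} (h : φ.IsSentence) (t : T) (f : ℕ → U) :
    M.TrueAt t φ ↔ M.Sat t f φ :=
  ⟨fun hT => hT f, fun hT g => by rw [Sat, M.truth_sentence h g f]; exact hT⟩

theorem termVal_subst (σ : ℕ → L.Term ℕ) (f : ℕ → U) (t : L.Term ℕ) :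
    M.termVal f (t.subst σ) = M.termVal (fun x => M.termVal f (σ x)) t := by
  induction t with
  | var x => rfl
  | func F ts ih => simp only [FirstOrder.Language.Term.subst, termVal, ih]

theorem truth_msubst {σ : ℕ → L.Term ℕ} (hσ : IsClosing σ) (φ : Formula L) (f : ℕ → U) :
    M.truth (φ.msubst σ) f = M.truth φ fun x => M.termVal f (σ x) := by
  induction φ generalizing σ f with
  | eq a b => simp only [msubst, truth, termVal_subst]
  | rel R ts => simp only [msubst, truth, termVal_subst]
  | and φ ψ ih ih' => simp only [msubst, truth, ih hσ, ih' hσ]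
  | neg φ ih | G φ ih | H φ ih => simp only [msubst, truth, ih hσ]
  | all y φ ih =>
    simp only [msubst, truth, ih (hσ.update y)]
    congr 3
    funext a
    congr 1
    funext x
    by_cases hxy : x = y
    · subst hxy; simp [termVal]
    · rcases hσ x with h | h
      · simp [hxy, h, termVal]
      · rw [Function.update_of_ne hxy, Function.update_of_ne hxy]
        exact M.termVal_congr fun z hz => (h.not_mem z hz).elim

end Premodel

namespace Premodel

section Clauses

variable {T : Type*} [LinearOrder T] {U : Type*} (M : Premodel L T U) {t : T} {f : ℕ → U}
  {φ ψ : Formula L}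

theorem sat_neg : M.Sat t f (neg φ) ↔ ¬ M.Sat t f φ := Iff.rfl

theorem sat_and : M.Sat t f (and φ ψ) ↔ M.Sat t f φ ∧ M.Sat t f ψ := Iff.rfl

theorem sat_imp : M.Sat t f (imp φ ψ) ↔ (M.Sat t f φ → M.Sat t f ψ) := by
  rw [imp, sat_neg, sat_and, sat_neg]; tauto

theorem sat_G : M.Sat t f (G φ) ↔ ∀ s, t < s → M.Sat s f φ := Iff.rfl

theorem sat_H : M.Sat t f (H φ) ↔ ∀ s, s < t → M.Sat s f φ := Iff.rfl

theorem sat_P : M.Sat t f (P φ) ↔ ∃ s, s < t ∧ M.Sat s f φ := by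
  rw [P, sat_neg, sat_H]; simp [sat_neg]

theorem sat_box : M.Sat t f (box φ) ↔ ∀ s, M.Sat s f φ := by
  rw [box, sat_and, sat_and, sat_G, sat_H]
  refine ⟨fun ⟨h1, h2, h3⟩ s => ?_, fun h => ⟨fun s _ => h s, h t, fun s _ => h s⟩⟩
  rcases lt_trichotomy s t with hs | rfl | hs
  exacts [h1 s hs, h2, h3 s hs]

theorem sat_conj {l : List (Formula L)} : M.Sat t f (conj l) ↔ ∀ φ ∈ l, M.Sat t f φ := by
  induction l with
  | nil => exact ⟨fun _ => by simp, fun _ => rfl⟩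
  | cons a l ih => rw [conj, sat_and, ih, List.forall_mem_cons]

theorem IsStandard.sat_all (h : M.IsStandard) {x : ℕ} :
    M.Sat t f (all x φ) ↔ ∀ a, M.Sat t (Function.update f x a) φ := by
  simp only [Sat, truth, admInf]
  rw [h]
  constructor
  · rintro ⟨Y, ⟨-, hY⟩, ht⟩ a
    exact hY ht _ ⟨a, rfl⟩
  · intro ha
    refine ⟨_, ⟨Set.mem_univ _, subset_rfl⟩, ?_⟩
    rintro _ ⟨a, rfl⟩
    exact ha a

end Clauses

/-- `M` validates every theorem of `L_ℝ`. -/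
def ValidatesLR {T : Type*} [LinearOrder T] {U : Type*} (M : Premodel L T U) : Prop :=
  ∀ φ ∈ LR L, ∀ (t : T) (f : ℕ → U), M.Sat t f φ

/-- In a standard model it suffices to validate the sentences among the theorems, because the
logic is closed under universal closure. -/
theorem IsStandard.validatesLR {T : Type*} [LinearOrder T] {U : Type*} {M : Premodel L T U}
    (hM : M.IsStandard)
    (h : ∀ φ ∈ LR L, φ.IsSentence → ∀ (t : T) (f : ℕ → U), M.Sat t f φ) : M.ValidatesLR := by
  intro φ hφ t f
  obtain ⟨n, hn⟩ := exists_allBelow_isSentence φ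
  have : M.Sat t f (φ.allBelow n) := h _ (allBelow_mem_LR hφ n) hn t f
  clear hn
  induction n with
  | zero => exact this
  | succ n ih =>
    have h' := (IsStandard.sat_all M hM).1 this (f n)
    rw [Function.update_eq_self] at h'
    exact ih h'

/-- A standard model satisfying all `L_ℝ`-theorems at one point validates them, because `□φ` is a
theorem whenever `φ` is one. -/
theorem IsStandard.validatesLR_of_sat {T : Type*} [LinearOrder T] {U : Type*}
    {M : Premodel L T U} (hM : M.IsStandard) {t₀ : T} {f₀ : ℕ → U}
    (h : ∀ φ ∈ LR L, M.Sat t₀ f₀ φ) : M.ValidatesLR := by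
  refine hM.validatesLR fun φ hφ hs t f => ?_
  have hbox : box φ ∈ LR L :=
    LR_taut₂ (Derivable.genH hφ) (LR_taut₂ hφ (Derivable.genG hφ) fun V hV h h' =>
      hV.and.2 ⟨h, h'⟩) fun V hV h h' => hV.and.2 ⟨h, h'⟩
  have := (M.sat_box).1 (h _ hbox) t
  rwa [Sat, M.truth_sentence hs f f₀]

end Premodel

/-! ### The real completion of a standard model over the rationals -/

section RealCompletion

variable {U : Type w} {M : Premodel L ℚ U} {D : ℝ → Set (Formula L)}

theorem consistent_of_sat {T : Type*} [LinearOrder T] {U : Type*} {M : Premodel L T U}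
    (hM : M.ValidatesLR) {Γ : Set (Formula L)}
    (h : ∀ l : List (Formula L), (∀ φ ∈ l, φ ∈ Γ) → ∃ t f, ∀ φ ∈ l, M.Sat t f φ) :
    Consistent (LR L) Γ := by
  intro l hl hn
  obtain ⟨t, f, hs⟩ := h l hl
  exact hM _ hn t f (M.sat_conj.2 hs)

theorem consistent_localTheory [Nonempty U] (hM : M.ValidatesLR) (r : ℝ) :
    Consistent (LR L) (localTheory M r) := by
  obtain ⟨a⟩ := ‹Nonempty U›
  refine consistent_of_sat hM fun l hl => ?_
  have : ∃ s t : ℝ, s < r ∧ r < t ∧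
      ∀ φ ∈ l, ∀ q : ℚ, s < (q : ℝ) → (q : ℝ) < t → M.TrueAt q φ := by
    induction l with
    | nil => exact ⟨r - 1, r + 1, by simp, by simp, by simp⟩
    | cons φ l ih =>
      obtain ⟨s, t, hs, ht, h⟩ := ih fun ψ hψ => hl ψ (by simp [hψ])
      obtain ⟨-, s', t', hs', ht', h'⟩ := hl φ (by simp)
      refine ⟨max s s', min t t', max_lt hs hs', lt_min ht ht', ?_⟩
      intro ψ hψ q hsq hqt
      rw [max_lt_iff] at hsq
      rw [lt_min_iff] at hqt
      rcases List.mem_cons.1 hψ with rfl | hψ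
      · exact h' q hsq.2 hqt.2
      · exact h ψ hψ q hsq.1 hqt.1
  obtain ⟨s, t, hs, ht, h⟩ := this
  obtain ⟨q, hq, hq'⟩ := exists_rat_btwn hs
  exact ⟨q, fun _ => a, fun φ hφ => h φ hφ q hq (hq'.trans ht) _⟩

theorem exists_isRealExtension [Nonempty U] (hM : M.ValidatesLR) :
    ∃ D : ℝ → Set (Formula L), IsRealExtension M D := by
  classical
  choose E hE hsub using fun r =>
    exists_maximalSentences (fun φ hφ => hφ.1) (consistent_localTheory hM r)
  refine ⟨fun r => if h : ∃ q : ℚ, (q : ℝ) = r then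
    {φ | φ.IsSentence ∧ M.TrueAt h.choose φ} else E r, fun q => ?_, fun r hr => ?_⟩
  · have h : ∃ q' : ℚ, (q' : ℝ) = q := ⟨q, rfl⟩
    have hq : h.choose = q := by exact_mod_cast h.choose_spec
    simp only [dif_pos h, hq]
  · have h : ¬ ∃ q : ℚ, (q : ℝ) = r := fun ⟨q, hq⟩ => hr ⟨q, hq⟩
    simp only [dif_neg h]
    exact ⟨hE r, hsub r⟩

namespace IsRealExtension

variable (hD : IsRealExtension M D)
include hD

theorem mem_rat {φ : Formula L} (hφ : φ.IsSentence) (q : ℚ) (f : ℕ → U) :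
    φ ∈ D q ↔ M.Sat q f φ := by
  rw [hD.1 q, ← M.trueAt_iff_sat hφ]
  exact ⟨fun h => h.2, fun h => ⟨hφ, h⟩⟩

theorem maximalSentences [Nonempty U] (hM : M.ValidatesLR) (r : ℝ) :
    MaximalSentences (LR L) (D r) := by
  obtain ⟨a⟩ := ‹Nonempty U›
  by_cases hr : Irrational r
  · exact (hD.2 r hr).1
  · obtain ⟨q, rfl⟩ : ∃ q : ℚ, (q : ℝ) = r := by simpa [Irrational] using hr
    have hs : ∀ φ ∈ D q, φ.IsSentence := fun φ hφ => by
      rw [hD.1] at hφ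
      exact hφ.1
    refine maximalSentences_of_complete hs
      (consistent_of_sat hM fun l hl => ⟨q, fun _ => a, fun φ hφ =>
        (hD.mem_rat (hs φ (hl φ hφ)) q _).1 (hl φ hφ)⟩) fun φ hφ => ?_
    rw [hD.mem_rat hφ q fun _ => a, hD.mem_rat (isSentence_neg.2 hφ) q fun _ => a, M.sat_neg]
    exact em _

theorem mem_of_near {r : ℝ} (hr : Irrational r) {φ : Formula L} (hφ : φ.IsSentence) (f : ℕ → U)
    {s t : ℝ} (hs : s < r) (ht : r < t)
    (h : ∀ q : ℚ, s < (q : ℝ) → (q : ℝ) < t → M.Sat q f φ) : φ ∈ D r :=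
  (hD.2 r hr).2 ⟨hφ, s, t, hs, ht, fun q h1 h2 => (M.trueAt_iff_sat hφ q f).2 (h q h1 h2)⟩

theorem mem_of_forall_rat {φ : Formula L} (hφ : φ.IsSentence) (f : ℕ → U)
    (h : ∀ q : ℚ, M.Sat q f φ) (r : ℝ) : φ ∈ D r := by
  by_cases hr : Irrational r
  · exact hD.mem_of_near hr hφ f (sub_one_lt r) (lt_add_one r) fun q _ _ => h q
  · obtain ⟨q, rfl⟩ : ∃ q : ℚ, (q : ℝ) = r := by simpa [Irrational] using hr
    exact (hD.mem_rat hφ q f).2 (h q)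

theorem mem_of_imp [Nonempty U] (hM : M.ValidatesLR) {φ ψ : Formula L} (hφ : φ.IsSentence)
    (hψ : ψ.IsSentence) (f : ℕ → U) (h : ∀ q : ℚ, M.Sat q f φ → M.Sat q f ψ) {r : ℝ}
    (hr : φ ∈ D r) : ψ ∈ D r :=
  ((hD.maximalSentences hM r).imp_mem hφ hψ).1
    (hD.mem_of_forall_rat (by simp [hφ, hψ]) f (fun q => M.sat_imp.2 (h q)) r) hr

end IsRealExtension

/-- The semantic content of the Dedekind completeness axiom in `M`. -/
theorem Premodel.ValidatesLR.dedekind (hM : M.ValidatesLR) (φ : Formula L) (f : ℕ → U)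
    (h : ∀ q, M.Sat q f (G φ) → ∃ q' < q, M.Sat q' f (G φ)) {q : ℚ} (hq : M.Sat q f (G φ)) :
    M.Sat q f (H φ) := by
  have hax : imp (box (imp (G φ) (P (G φ)))) (imp (G φ) (H φ)) ∈ LR L :=
    Derivable.ax (.inr (.dedekind φ))
  refine M.sat_imp.1 (M.sat_imp.1 (hM _ hax q f) (M.sat_box.2 fun s => M.sat_imp.2 fun hs => ?_)) hq
  exact M.sat_P.2 (h s hs)

theorem lt_or_lt_of_irrational {r : ℝ} (hr : Irrational r) (q : ℚ) : (q : ℝ) < r ∨ r < q :=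
  lt_or_gt_of_ne fun h => hr ⟨q, h⟩

namespace IsRealExtension

variable [Nonempty U] (hD : IsRealExtension M D) (hM : M.ValidatesLR)
include hD hM

/-- The family `D` treats `G` as truth at all later reals. When `φ` is true at all rationals above
an irrational `r`, then `Gφ` is true at some rational below `r`: otherwise the cut at `r` refutes an
instance of the Dedekind axiom. -/
theorem G_mem_iff {φ : Formula L} (hφ : φ.IsSentence) (r : ℝ) :
    G φ ∈ D r ↔ ∀ s, r < s → φ ∈ D s := by
  have f : ℕ → U := fun _ => Classical.arbitrary U
  constructor
  · intro h s hs
    have key : ∀ q : ℚ, r < q → M.Sat q f φ := by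
      by_cases hr : Irrational r
      · by_contra! hcon
        obtain ⟨q₀, hq₀, hn⟩ := hcon
        refine ((hD.maximalSentences hM r).neg_mem (isSentence_G.2 hφ)).1 ?_ h
        refine hD.mem_of_near hr (by simpa using hφ) f (sub_one_lt r) hq₀ fun q _ hq => ?_
        exact fun hG => hn (hG q₀ (by exact_mod_cast hq))
      · obtain ⟨p, rfl⟩ : ∃ q : ℚ, (q : ℝ) = r := by simpa [Irrational] using hr
        intro q hq
        exact (hD.mem_rat (isSentence_G.2 hφ) p f).1 h q (by exact_mod_cast hq)
    by_cases hs' : Irrational s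
    · exact hD.mem_of_near hs' hφ f hs (lt_add_one s) fun q hq _ => key q hq
    · obtain ⟨p, rfl⟩ : ∃ q : ℚ, (q : ℝ) = s := by simpa [Irrational] using hs'
      exact (hD.mem_rat hφ p f).2 (key p hs)
  · intro h
    have key : ∀ q : ℚ, r < q → M.Sat q f φ := fun q hq => (hD.mem_rat hφ q f).1 (h q hq)
    by_cases hr : Irrational r
    · by_cases hex : ∃ q₁ : ℚ, (q₁ : ℝ) < r ∧ M.Sat q₁ f (G φ)
      · obtain ⟨q₁, hq₁, hG⟩ := hex
        refine hD.mem_of_near hr (isSentence_G.2 hφ) f hq₁ (lt_add_one r) fun q hq _ => ?_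
        exact fun s hs => hG s ((by exact_mod_cast hq : q₁ < q).trans hs)
      · exfalso
        push Not at hex
        obtain ⟨q₂, hq₂, -⟩ := exists_rat_btwn (lt_add_one r)
        obtain ⟨q₁, -, hq₁⟩ := exists_rat_btwn (sub_one_lt r)
        have hGabove : ∀ q : ℚ, r < q → M.Sat q f (G φ) := fun q hq s hs =>
          key s (hq.trans (by exact_mod_cast hs))
        have hH : M.Sat q₂ f (H φ) := by
          refine hM.dedekind φ f (fun q hq => ?_) (hGabove q₂ hq₂)
          rcases lt_or_lt_of_irrational hr q with hlt | hlt
          · exact (hex q hlt hq).elim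
          · obtain ⟨q', h1, h2⟩ := exists_rat_btwn hlt
            exact ⟨q', by exact_mod_cast h2, hGabove q' h1⟩
        refine hex q₁ hq₁ fun s _ => ?_
        rcases lt_or_ge s q₂ with hs | hs
        · exact hH s hs
        · exact key s (hq₂.trans_le (by exact_mod_cast hs))
    · obtain ⟨p, rfl⟩ : ∃ q : ℚ, (q : ℝ) = r := by simpa [Irrational] using hr
      exact (hD.mem_rat (isSentence_G.2 hφ) p f).2 fun q hq => key q (by exact_mod_cast hq)

/-- The family `D` treats `H` as truth at all earlier reals. Here the cut at an irrational is
closed off by the Dedekind axiom for `¬Hφ`. -/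
theorem H_mem_iff {φ : Formula L} (hφ : φ.IsSentence) (r : ℝ) :
    H φ ∈ D r ↔ ∀ s, s < r → φ ∈ D s := by
  have f : ℕ → U := fun _ => Classical.arbitrary U
  constructor
  · intro h s hs
    have key : ∀ q : ℚ, (q : ℝ) < r → M.Sat q f φ := by
      by_cases hr : Irrational r
      · by_contra! hcon
        obtain ⟨q₀, hq₀, hn⟩ := hcon
        refine ((hD.maximalSentences hM r).neg_mem (isSentence_H.2 hφ)).1 ?_ h
        refine hD.mem_of_near hr (by simpa using hφ) f hq₀ (lt_add_one r) fun q hq _ => ?_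
        exact fun hG => hn (hG q₀ (by exact_mod_cast hq))
      · obtain ⟨p, rfl⟩ : ∃ q : ℚ, (q : ℝ) = r := by simpa [Irrational] using hr
        intro q hq
        exact (hD.mem_rat (isSentence_H.2 hφ) p f).1 h q (by exact_mod_cast hq)
    by_cases hs' : Irrational s
    · exact hD.mem_of_near hs' hφ f (sub_one_lt s) hs fun q _ hq => key q hq
    · obtain ⟨p, rfl⟩ : ∃ q : ℚ, (q : ℝ) = s := by simpa [Irrational] using hs'
      exact (hD.mem_rat hφ p f).2 (key p hs)
  · intro h
    have key : ∀ q : ℚ, (q : ℝ) < r → M.Sat q f φ := fun q hq => (hD.mem_rat hφ q f).1 (h q hq)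
    by_cases hr : Irrational r
    · by_cases hex : ∃ q₁ : ℚ, r < (q₁ : ℝ) ∧ M.Sat q₁ f (H φ)
      · obtain ⟨q₁, hq₁, hH⟩ := hex
        refine hD.mem_of_near hr (isSentence_H.2 hφ) f (sub_one_lt r) hq₁ fun q _ hq => ?_
        exact fun s hs => hH s (hs.trans (by exact_mod_cast hq : q < q₁))
      · exfalso
        push Not at hex
        obtain ⟨q₂, hq₂, -⟩ := exists_rat_btwn (lt_add_one r)
        obtain ⟨q₁, -, hq₁⟩ := exists_rat_btwn (sub_one_lt r)
        have hbelow : ∀ q : ℚ, (q : ℝ) < r → M.Sat q f (H φ) := fun q hq s hs =>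
          key s (lt_trans (by exact_mod_cast hs) hq)
        have hGabove : ∀ q : ℚ, r < q → M.Sat q f (G (neg (H φ))) := fun q hq s hs =>
          hex s (hq.trans (by exact_mod_cast hs))
        have hH : M.Sat q₂ f (H (neg (H φ))) := by
          refine hM.dedekind (neg (H φ)) f (fun q hq => ?_) (hGabove q₂ hq₂)
          rcases lt_or_lt_of_irrational hr q with hlt | hlt
          · obtain ⟨q', h1, h2⟩ := exists_rat_btwn hlt
            exact (hq q' (by exact_mod_cast h1) (hbelow q' h2)).elim
          · obtain ⟨q', h1, h2⟩ := exists_rat_btwn hlt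
            exact ⟨q', by exact_mod_cast h2, hGabove q' h1⟩
        exact hH q₁ (by exact_mod_cast hq₁.trans hq₂) (hbelow q₁ hq₁)
    · obtain ⟨p, rfl⟩ : ∃ q : ℚ, (q : ℝ) = r := by simpa [Irrational] using hr
      exact (hD.mem_rat (isSentence_H.2 hφ) p f).2 fun q hq => key q (by exact_mod_cast hq)

/-- The premodel over the reals whose admissible propositions are the sets
`{r | φ ∈ D r}`, for `φ` a sentence. -/
def realPremodel (name : U → L.Term ℕ) : Premodel L ℝ U where
  Adm := {X | ∃ φ : Formula L, φ.IsSentence ∧ X = {r | φ ∈ D r}}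
  nonempty := by
    let χ : Formula L := all 0 verum
    have hχ : χ.IsSentence := by
      simp [χ, IsSentence, verum, freeVars, FirstOrder.Language.Term.varFinset]
    exact ⟨_, χ, hχ, rfl⟩
  compl_mem := by
    rintro _ ⟨φ, hφ, rfl⟩
    exact ⟨neg φ, hφ, Set.ext fun r => ((hD.maximalSentences hM r).neg_mem hφ).symm⟩
  inter_mem := by
    rintro _ ⟨φ, hφ, rfl⟩ _ ⟨ψ, hψ, rfl⟩
    exact ⟨and φ ψ, isSentence_and.2 ⟨hφ, hψ⟩,
      Set.ext fun r => (hD.maximalSentences hM r).and_mem.symm⟩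
  boxLT_mem := by
    rintro _ ⟨φ, hφ, rfl⟩
    exact ⟨G φ, hφ, Set.ext fun r => (hD.G_mem_iff hM hφ r).symm⟩
  boxGT_mem := by
    rintro _ ⟨φ, hφ, rfl⟩
    exact ⟨H φ, hφ, Set.ext fun r => (hD.H_mem_iff hM hφ r).symm⟩
  funVal := M.funVal
  relVal R a := {r | rel R (fun i => name (a i)) ∈ D r}

variable {name : U → L.Term ℕ}
  (hname : ∀ a : U, ClosedTerm (name a) ∧ ∀ f : ℕ → U, M.termVal f (name a) = a)

theorem realPremodel_termVal (f : ℕ → U) (t : L.Term ℕ) :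
    (hD.realPremodel hM name).termVal f t = M.termVal f t := by
  induction t with
  | var x => rfl
  | func F ts ih =>
    simp only [Premodel.termVal, ih]
    rfl

omit hD hM [Nonempty U] in
include hname in
theorem sat_msubst_name (q : ℚ) (f f' : ℕ → U) (φ : Formula L) :
    M.Sat q f' (φ.msubst fun x => name (f x)) ↔ M.Sat q f φ := by
  rw [Premodel.Sat, M.truth_msubst (isClosing_of_closed fun x => (hname _).1)]
  simp only [(hname _).2]
  rfl

include hname in
/-- The truth lemma for the real completion. In the quantifier case, an admissible set
`{r | ψ ∈ D r}` below all instances of `∀xφ` makes `ψ → ∀xφ` true at all rationals, since `M` is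
standard, and hence a member of every `D r`. -/
theorem realPremodel_truth (hstd : M.IsStandard) (φ : Formula L) (f : ℕ → U) :
    (hD.realPremodel hM name).truth φ f = {r | φ.msubst (fun x => name (f x)) ∈ D r} := by
  have hcl : ∀ f : ℕ → U, ∀ x, ClosedTerm (name (f x)) := fun f x => (hname _).1
  induction φ generalizing f with
  | eq a b =>
    have hs : (msubst (fun x => name (f x)) (eq a b)).IsSentence := isSentence_msubst (hcl f) _
    ext r
    simp only [Premodel.truth, Set.mem_ofPred_eq, realPremodel_termVal]
    by_cases h : M.termVal f a = M.termVal f b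
    · refine iff_of_true h (hD.mem_of_forall_rat hs f (fun q => ?_) r)
      exact (sat_msubst_name hname q f f (eq a b)).2 h
    · refine iff_of_false h (((hD.maximalSentences hM r).neg_mem hs).1
        (hD.mem_of_forall_rat (isSentence_neg.2 hs) f (fun q => ?_) r))
      exact fun hq => h ((sat_msubst_name hname q f f (eq a b)).1 hq)
  | rel R ts =>
    have hs : (msubst (fun x => name (f x)) (rel R ts)).IsSentence := isSentence_msubst (hcl f) _
    have hs' : (rel R fun i => name (M.termVal f (ts i))).IsSentence := 
      isSentence_rel fun i => (hname _).1
    have hiff : ∀ q : ℚ, M.Sat q f (rel R fun i => name (M.termVal f (ts i))) ↔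
        M.Sat q f (msubst (fun x => name (f x)) (rel R ts)) := by
      intro q
      rw [sat_msubst_name hname]
      simp only [Premodel.Sat, Premodel.truth, (hname _).2]
    ext r
    simp only [Premodel.truth, realPremodel_termVal]
    exact ⟨hD.mem_of_imp hM hs' hs f fun q => (hiff q).1,
      hD.mem_of_imp hM hs hs' f fun q => (hiff q).2⟩
  | and φ ψ ih ih' =>
    ext r
    simp only [Premodel.truth, ih, ih', msubst]
    exact (hD.maximalSentences hM r).and_mem.symm
  | neg φ ih =>
    ext r
    simp only [Premodel.truth, ih, msubst]
    exact ((hD.maximalSentences hM r).neg_mem (isSentence_msubst (hcl f) φ)).symm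
  | G φ ih =>
    ext r
    simp only [Premodel.truth, ih, msubst]
    exact (hD.G_mem_iff hM (isSentence_msubst (hcl f) φ) r).symm
  | H φ ih =>
    ext r
    simp only [Premodel.truth, ih, msubst]
    exact (hD.H_mem_iff hM (isSentence_msubst (hcl f) φ) r).symm
  | all x φ ih =>
    have hs : (msubst (fun x => name (f x)) (all x φ)).IsSentence := isSentence_msubst (hcl f) _
    have hupd : ∀ a, (fun y => name (Function.update f x a y)) =
        Function.update (fun y => name (f y)) x (name a) := by
      intro a
      funext y
      by_cases hy : y = x
      · subst hy; simp
      · simp [hy]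
    ext r
    simp only [Premodel.truth, ih, Premodel.admInf]
    constructor
    · rintro ⟨_, ⟨⟨ψ, hψ, rfl⟩, hsub⟩, hr⟩
      refine hD.mem_of_imp hM hψ hs f (fun q hq => ?_) hr
      rw [sat_msubst_name hname, hstd.sat_all]
      intro a
      have : (q : ℝ) ∈ {r | msubst (fun y => name (Function.update f x a y)) φ ∈ D r} :=
        hsub ((hD.mem_rat hψ q f).2 hq) _ ⟨a, rfl⟩
      exact (sat_msubst_name hname q _ f φ).1
        ((hD.mem_rat (isSentence_msubst (hcl _) φ) q f).1 this)
    · intro hr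
      refine ⟨_, ⟨⟨_, hs, rfl⟩, ?_⟩, hr⟩
      rintro s hs' _ ⟨a, rfl⟩
      simp only [Set.mem_ofPred_eq, hupd]
      refine (hD.maximalSentences hM s).mp ?_ ?_ hs'
      · rw [← hupd]; exact isSentence_msubst (hcl _) φ
      · rw [← msubst_update_subst (isClosing_of_closed (hcl f))]
        exact LR_all_imp_subst x _ (hname a).1

end IsRealExtension

/-- The transfer from `ℚ` to `ℝ`, for a standard model that validates `L_ℝ`. -/
theorem real_completion [Nonempty U] {name : U → L.Term ℕ} (hM : M.ValidatesLR)
    (hstd : M.IsStandard)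
    (hname : ∀ a : U, ClosedTerm (name a) ∧ ∀ f : ℕ → U, M.termVal f (name a) = a)
    (hD : IsRealExtension M D) :
    (∀ r : ℝ, MaximalSentences (LR L) (D r)) ∧
    ∃ N : Premodel L ℝ U, IsRealCompletion M name D N ∧
      (∀ φ : Formula L, φ.IsSentence → ∀ f : ℕ → U, N.truth φ f = {r : ℝ | φ ∈ D r}) ∧
      N.IsModel ∧
      (∀ φ : Formula L, φ.IsSentence → ∀ q : ℚ, N.TrueAt (q : ℝ) φ ↔ M.TrueAt q φ) ∧
      (∀ (φ : Formula L) (q : ℚ) (f : ℕ → U), N.Sat (q : ℝ) f φ ↔ M.Sat q f φ) := by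
  have htruth := hD.realPremodel_truth hM hname hstd
  have hsat : ∀ (φ : Formula L) (q : ℚ) (f : ℕ → U),
      (hD.realPremodel hM name).Sat (q : ℝ) f φ ↔ M.Sat q f φ := by
    intro φ q f
    rw [Premodel.Sat, htruth, Set.mem_ofPred_eq,
      hD.mem_rat (isSentence_msubst (fun x => (hname _).1) φ) q f,
      IsRealExtension.sat_msubst_name hname]
  refine ⟨hD.maximalSentences hM, hD.realPremodel hM name,
    ⟨rfl, fun F a => rfl, fun R a => rfl⟩, fun φ hφ f => ?_, fun φ f => ?_,
    fun φ hφ q => forall_congr' fun f => hsat φ q f, hsat⟩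
  · rw [htruth, msubst_sentence hφ]
  · exact ⟨_, isSentence_msubst (fun x => (hname _).1) φ, htruth φ f⟩

end RealCompletion

/-! ### Saturated sets of sentences -/

theorem LR_all_imp {x : ℕ} {α : Formula L} (h : x ∉ α.freeVars) (φ : Formula L) :
    imp (all x (imp α φ)) (imp α (all x φ)) ∈ LR L := by
  refine LR_taut₂ (Derivable.distribution x α φ) (Derivable.vacuous x α h) fun V hV => ?_
  simp only [hV.imp]; tauto

/-- A set of sentences that proves `∀xφ` whenever it proves every closed instance of `φ`. -/
def ClosedComplete (Γ : Set (Formula L)) : Prop :=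
  ∀ (φ : Formula L) (x : ℕ), (all x φ).IsSentence →
    (∀ τ : L.Term ℕ, ClosedTerm τ → Γ ⊩ φ.subst x τ) → Γ ⊩ all x φ

/-- Maximal sets of sentences in which every false universal sentence has a closed
counterinstance. -/
def SaturatedSentences (Γ : Set (Formula L)) : Prop :=
  MaximalSentences (LR L) Γ ∧ ∀ (φ : Formula L) (x : ℕ), (all x φ).IsSentence →
    (∀ τ : L.Term ℕ, ClosedTerm τ → φ.subst x τ ∈ Γ) → all x φ ∈ Γ

theorem not_mem_freeVars_of_sentence {φ : Formula L} (h : φ.IsSentence) (x : ℕ) :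
    x ∉ φ.freeVars := by
  rw [h]; simp

/-- Adding one sentence preserves `ClosedComplete`, since `Γ, α ⊢ φ(τ)` amounts to
`Γ ⊢ (α → φ)(τ)`. -/
theorem ClosedComplete.insert {Γ : Set (Formula L)} (h : ClosedComplete Γ) {α : Formula L}
    (hα : α.IsSentence) : ClosedComplete (insert α Γ) := by
  intro φ x hs hτ
  rw [proves_insert]
  refine (Proves.of_LR (LR_all_imp (not_mem_freeVars_of_sentence hα x) φ)).mp
    (h (imp α φ) x ?_ fun τ hcl => ?_)
  · have : (imp α φ).freeVars = φ.freeVars := by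
      change α.freeVars ∪ φ.freeVars = φ.freeVars
      rw [hα, Finset.empty_union]
    rw [IsSentence, freeVars, this]
    exact hs
  · have := proves_insert.1 (hτ τ hcl)
    rwa [← subst_of_not_free (not_mem_freeVars_of_sentence hα x) τ] at this

/-- Henkin's lemma, for a countable language: a consistent closed-complete set of sentences has a
saturated extension. It is obtained as the union of a generic ideal of such sets. -/
theorem exists_saturatedSentences [Countable (Formula L)] {Γ : Set (Formula L)}
    (hs : ∀ φ ∈ Γ, φ.IsSentence) (hc : Consistent (LR L) Γ) (hcc : ClosedComplete Γ) :
    ∃ Θ, SaturatedSentences Θ ∧ Γ ⊆ Θ := by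
  obtain ⟨_⟩ := nonempty_encodable (Formula L)
  let C := {Θ : Set (Formula L) //
    (∀ φ ∈ Θ, φ.IsSentence) ∧ Consistent (LR L) Θ ∧ ClosedComplete Θ}
  have hins : ∀ (Θ : C) {α : Formula L}, α.IsSentence → ¬ Θ.1 ⊩ neg α →
      ∃ Θ' : C, Θ ≤ Θ' ∧ α ∈ Θ'.1 := fun Θ α hα hn =>
    ⟨⟨insert α Θ.1, by simpa using ⟨hα, Θ.2.1⟩, consistent_insert.2 hn, Θ.2.2.2.insert hα⟩,
      Set.subset_insert _ _, Set.mem_insert _ _⟩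
  let decides : Formula L → Order.Cofinal C := fun φ =>
    { carrier := {Θ | φ.IsSentence → φ ∈ Θ.1 ∨ neg φ ∈ Θ.1}
      isCofinal := by
        intro Θ
        by_cases hφ : φ.IsSentence
        · by_cases h : Θ.1 ⊩ neg φ
          · obtain ⟨Θ', hle, hmem⟩ := hins Θ (α := neg φ) hφ fun h' => Θ.2.2.1.not_both h h'
            exact ⟨Θ', fun _ => .inr hmem, hle⟩
          · obtain ⟨Θ', hle, hmem⟩ := hins Θ hφ h
            exact ⟨Θ', fun _ => .inl hmem, hle⟩
        · exact ⟨Θ, fun h => (hφ h).elim, le_rfl⟩ }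
  let witness : ℕ × Formula L → Order.Cofinal C := fun a =>
    { carrier := {Θ | (all a.1 a.2).IsSentence → all a.1 a.2 ∈ Θ.1 ∨
        ∃ τ : L.Term ℕ, ClosedTerm τ ∧ neg (a.2.subst a.1 τ) ∈ Θ.1}
      isCofinal := by
        intro Θ
        by_cases hφ : (all a.1 a.2).IsSentence
        · by_cases h : Θ.1 ⊩ neg (all a.1 a.2)
          · have : ∃ τ : L.Term ℕ, ClosedTerm τ ∧ ¬ Θ.1 ⊩ a.2.subst a.1 τ := by
              by_contra! hcon
              exact Θ.2.2.1.not_both (Θ.2.2.2 a.2 a.1 hφ hcon) h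
            obtain ⟨τ, hτ, hn⟩ := this
            obtain ⟨Θ', hle, hmem⟩ := hins Θ (α := neg (a.2.subst a.1 τ))
              (isSentence_subst hφ hτ) fun h' => hn (h'.taut₁ fun V hV => by
                simp only [hV.neg]; tauto)
            exact ⟨Θ', fun _ => .inr ⟨τ, hτ, hmem⟩, hle⟩
          · obtain ⟨Θ', hle, hmem⟩ := hins Θ hφ h
            exact ⟨Θ', fun _ => .inl hmem, hle⟩
        · exact ⟨Θ, fun h => (hφ h).elim, le_rfl⟩ }
  let Γ₀ : C := ⟨Γ, hs, hc, hcc⟩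
  let 𝒟 : Formula L ⊕ (ℕ × Formula L) → Order.Cofinal C := Sum.elim decides witness
  let I := Order.idealOfCofinals Γ₀ 𝒟
  let Θ : Set (Formula L) := {φ | ∃ Ξ ∈ I, φ ∈ Ξ.1}
  have hfin : ∀ l : List (Formula L), (∀ φ ∈ l, φ ∈ Θ) → ∃ Ξ ∈ I, ∀ φ ∈ l, φ ∈ Ξ.1 := by
    intro l
    induction l with
    | nil => exact fun _ => ⟨Γ₀, Order.mem_idealOfCofinals _ _, by simp⟩
    | cons a l ih =>
      intro hl
      obtain ⟨Ξ, hΞ, h⟩ := ih fun φ hφ => hl φ (by simp [hφ])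
      obtain ⟨Ξ', hΞ', h'⟩ := hl a (by simp)
      obtain ⟨Ξ'', hΞ'', h1, h2⟩ := I.directed Ξ hΞ Ξ' hΞ'
      exact ⟨Ξ'', hΞ'', by simpa using ⟨h2 h', fun φ hφ => h1 (h φ hφ)⟩⟩
  have hcons : Consistent (LR L) Θ := fun l hl =>
    let ⟨Ξ, _, h⟩ := hfin l hl
    Ξ.2.2.1 l h
  have hmax : MaximalSentences (LR L) Θ := by
    refine maximalSentences_of_complete (fun φ ⟨Ξ, _, h⟩ => Ξ.2.1 φ h) hcons fun φ hφ => ?_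
    obtain ⟨Ξ, hΞ, hI⟩ := Order.cofinal_meets_idealOfCofinals Γ₀ 𝒟 (.inl φ)
    exact (hΞ hφ).imp (fun h => ⟨Ξ, hI, h⟩) fun h => ⟨Ξ, hI, h⟩
  refine ⟨Θ, ⟨hmax, fun φ x hφ hall => ?_⟩, fun φ hφ => ⟨Γ₀, Order.mem_idealOfCofinals _ _, hφ⟩⟩
  obtain ⟨Ξ, hΞ, hI⟩ := Order.cofinal_meets_idealOfCofinals Γ₀ 𝒟 (.inr (x, φ))
  rcases hΞ hφ with h | ⟨τ, hτ, h⟩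
  · exact ⟨Ξ, hI, h⟩
  · exact ((hmax.neg_mem (isSentence_subst hφ hτ)).1 ⟨Ξ, hI, h⟩ (hall τ hτ)).elim

/-! ### Modal reasoning in both temporal directions -/

namespace Formula

/-- `G` and `H` as one operator: `true` stands for the future, `false` for the past. -/
def always : Bool → Formula L → Formula L
  | true, φ => G φ
  | false, φ => H φ

/-- `F` for `true` and `P` for `false`. -/
def sometime (d : Bool) (φ : Formula L) : Formula L := neg (always d (neg φ))

end Formula

@[simp] theorem isSentence_always {d : Bool} {φ : Formula L} :
    (always d φ).IsSentence ↔ φ.IsSentence := by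
  cases d <;> rfl

@[simp] theorem isSentence_sometime {d : Bool} {φ : Formula L} :
    (sometime d φ).IsSentence ↔ φ.IsSentence := by
  cases d <;> rfl

theorem freeVars_always (d : Bool) (φ : Formula L) : (always d φ).freeVars = φ.freeVars := by
  cases d <;> rfl

theorem subst_always (d : Bool) (x : ℕ) (τ : L.Term ℕ) (φ : Formula L) :
    (always d φ).subst x τ = always d (φ.subst x τ) := by
  cases d <;> rfl

theorem LR_nec (d : Bool) {φ : Formula L} (h : φ ∈ LR L) : always d φ ∈ LR L := by
  cases d
  exacts [Derivable.genH h, Derivable.genG h]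

theorem LR_dist (d : Bool) (φ ψ : Formula L) :
    imp (always d (imp φ ψ)) (imp (always d φ) (always d ψ)) ∈ LR L := by
  cases d
  exacts [Derivable.distH φ ψ, Derivable.distG φ ψ]

theorem LR_conv (d : Bool) (φ : Formula L) :
    imp φ (always d (sometime (!d) φ)) ∈ LR L := by
  cases d
  exacts [Derivable.convHF φ, Derivable.convGP φ]

theorem LR_trans (d : Bool) (φ : Formula L) :
    imp (always d φ) (always d (always d φ)) ∈ LR L := by
  cases d
  exacts [Derivable.ax (.inl (.transH φ)), Derivable.ax (.inl (.transG φ))]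

theorem LR_linear (d : Bool) (φ ψ : Formula L) :
    imp (and (sometime d φ) (sometime d ψ))
      (or (or (sometime d (and φ ψ)) (sometime d (and φ (sometime d ψ))))
        (sometime d (and (sometime d φ) ψ))) ∈ LR L := by
  cases d
  exacts [Derivable.ax (.inl (.linearP φ ψ)), Derivable.ax (.inl (.linearF φ ψ))]

theorem LR_endless (d : Bool) (φ : Formula L) : imp (always d φ) (sometime d φ) ∈ LR L := by
  cases d
  exacts [Derivable.ax (.inl (.endlessH φ)), Derivable.ax (.inl (.endlessG φ))]

theorem LR_dense (d : Bool) (φ : Formula L) :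
    imp (always d (always d φ)) (always d φ) ∈ LR L := by
  cases d
  exacts [Derivable.ax (.inl (.denseH φ)), Derivable.ax (.inl (.denseG φ))]

theorem LR_always_mono (d : Bool) {φ ψ : Formula L} (h : imp φ ψ ∈ LR L) :
    imp (always d φ) (always d ψ) ∈ LR L :=
  LR_mp (LR_dist d φ ψ) (LR_nec d h)

/-- `PGφ → φ` and its mirror image, by contraposition of the converse axioms. -/
theorem LR_sometime_always (d : Bool) (φ : Formula L) :
    imp (sometime (!d) (always d φ)) φ ∈ LR L := by
  have h1 := LR_conv (!d) (neg φ)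
  rw [Bool.not_not] at h1
  have h2 : imp (sometime d (neg φ)) (neg (always d φ)) ∈ LR L :=
    LR_taut₁ (LR_always_mono d (φ := φ) (ψ := neg (neg φ)) (LR_taut fun V hV => by
      simp only [hV.imp, hV.neg]; tauto)) fun V hV => by
        simp only [sometime, hV.imp, hV.neg]; tauto
  refine LR_taut₂ h1 (LR_always_mono (!d) h2) fun V hV => ?_
  rw [show sometime (!d) (always d φ) = neg (always (!d) (neg (always d φ))) from rfl]
  simp only [hV.imp, hV.neg]
  tauto

/-- The Barcan formula: it is derivable because `G` and `H` are adjoint to `P` and `F`. -/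
theorem LR_barcan (d : Bool) (x : ℕ) (φ : Formula L) :
    imp (all x (always d φ)) (always d (all x φ)) ∈ LR L := by
  have h1 : imp (all x (always d φ)) (always d φ) ∈ LR L := by
    have := Derivable.instantiation (Ax := {α | RationalAxiom α ∨ DedekindAxiom α}) x
      (always d φ) (.var x) (freeFor_self x _)
    rwa [subst_self] at this
  have h2 : imp (sometime (!d) (all x (always d φ))) (sometime (!d) (always d φ)) ∈ LR L :=
    LR_taut₁ (LR_always_mono (!d) (φ := neg (always d φ)) (ψ := neg (all x (always d φ)))
      (LR_taut₁ h1 fun V hV => by simp only [hV.imp, hV.neg]; tauto)) fun V hV => by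
        rw [sometime, sometime]; simp only [hV.imp, hV.neg]; tauto
  have h3 : imp (sometime (!d) (all x (always d φ))) φ ∈ LR L :=
    LR_taut₂ h2 (LR_sometime_always d φ) fun V hV => by simp only [hV.imp]; tauto
  have hx : x ∉ (sometime (!d) (all x (always d φ))).freeVars := by
    rw [sometime]
    simp only [freeVars, freeVars_always]
    exact Finset.notMem_erase _ _
  have h4 := LR_mp (LR_all_imp hx φ) (Derivable.genAll x h3)
  exact LR_taut₂ (LR_conv d (all x (always d φ))) (LR_always_mono d h4) fun V hV => by
    simp only [hV.imp]; tauto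

/-! ### The canonical frame -/

section Canonical

variable {Γ Δ Θ : Set (Formula L)} {d : Bool}

/-- The canonical accessibility relation in direction `d`. -/
def Sees (d : Bool) (Γ Δ : Set (Formula L)) : Prop :=
  ∀ φ : Formula L, φ.IsSentence → always d φ ∈ Γ → φ ∈ Δ

theorem MaximalSentences.always_mono (hΓ : MaximalSentences (LR L) Γ) {φ ψ : Formula L}
    (hψ : ψ.IsSentence) (h : imp φ ψ ∈ LR L) (hφ : always d φ ∈ Γ) : always d ψ ∈ Γ :=
  hΓ.mp (by simpa using hψ) (LR_always_mono d h) hφ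

theorem Sees.symm (hΓ : MaximalSentences (LR L) Γ) (hΔ : MaximalSentences (LR L) Δ)
    (h : Sees d Γ Δ) : Sees (!d) Δ Γ := by
  intro φ hφ hmem
  by_contra hn
  have h1 := hΓ.mp (by simpa using hφ) (LR_conv d (neg φ)) ((hΓ.neg_mem hφ).2 hn)
  refine (hΔ.neg_mem (by simpa using hφ)).1 (h _ (by simpa using hφ) h1) ?_
  exact hΔ.always_mono (by simpa using hφ) (LR_taut fun V hV => by
    simp only [hV.imp, hV.neg]; tauto) hmem

theorem Sees.trans (hΓ : MaximalSentences (LR L) Γ) (h : Sees d Γ Δ) (h' : Sees d Δ Θ) :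
    Sees d Γ Θ := fun φ hφ hmem =>
  h' φ hφ (h _ (by simpa using hφ) (hΓ.mp (by simpa using hφ) (LR_trans d φ) hmem))

theorem Sees.sometime_mem (hΓ : MaximalSentences (LR L) Γ) (hΔ : MaximalSentences (LR L) Δ)
    (h : Sees d Γ Δ) {φ : Formula L} (hφ : φ ∈ Δ) : sometime d φ ∈ Γ := by
  have hs := hΔ.1 φ hφ
  rw [sometime, hΓ.neg_mem (by simpa using hs)]
  exact fun hn => (hΔ.neg_mem hs).1 (h _ (by simpa using hs) hn) hφ

/-- The sentences that hold throughout the `d`-direction of `Γ`. -/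
def unbox (d : Bool) (Γ : Set (Formula L)) : Set (Formula L) :=
  {φ | φ.IsSentence ∧ always d φ ∈ Γ}

theorem always_mem_of_unbox_proves (hΓ : MaximalSentences (LR L) Γ) {φ : Formula L}
    (hφ : φ.IsSentence) (h : unbox d Γ ⊩ φ) : always d φ ∈ Γ := by
  obtain ⟨l, hl, h⟩ := h
  have key : ∀ l : List (Formula L), (∀ ψ ∈ l, ψ ∈ unbox d Γ) → Γ ⊩ always d (conj l) := by
    intro l
    induction l with
    | nil => exact fun _ => Proves.of_LR (LR_nec d verum_mem_LR)
    | cons a l ih =>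
      intro hl
      have ha : Γ ⊩ always d a := Proves.of_mem (hl a (by simp)).2
      have h1 : imp (always d a) (always d (imp (conj l) (conj (a :: l)))) ∈ LR L :=
        LR_always_mono d (LR_taut fun V hV => by
          simp only [conj, hV.imp, hV.and]; tauto)
      exact ((Proves.of_LR (LR_dist d _ _)).mp ((Proves.of_LR h1).mp ha)).mp
        (ih fun ψ hψ => hl ψ (by simp [hψ]))
  exact hΓ.mem_of_proves (by simpa using hφ)
    ((Proves.of_LR (LR_always_mono d h)).mp (key l hl))

/-- By the Barcan formula, `unbox d Γ` inherits closedness under the infinitary rule. -/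
theorem closedComplete_unbox (hΓ : SaturatedSentences Γ) (d : Bool) :
    ClosedComplete (unbox d Γ) := by
  intro φ x hs hτ
  have hs' : (all x (always d φ)).IsSentence := by
    rw [IsSentence, freeVars, freeVars_always]
    exact hs
  refine Proves.of_mem ⟨hs, hΓ.1.mp (by simpa using hs) (LR_barcan d x φ) (hΓ.2 _ x hs' ?_)⟩
  intro τ hcl
  rw [subst_always]
  exact always_mem_of_unbox_proves hΓ.1 (isSentence_subst hs hcl) (hτ τ hcl)

variable [Countable (Formula L)]

theorem SaturatedSentences.exists_sees_not_mem (hΓ : SaturatedSentences Γ) {φ : Formula L}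
    (hφ : φ.IsSentence) (h : always d φ ∉ Γ) :
    ∃ Δ, SaturatedSentences Δ ∧ Sees d Γ Δ ∧ φ ∉ Δ := by
  have hc : Consistent (LR L) (insert (neg φ) (unbox d Γ)) := by
    refine consistent_insert.2 fun hn => h (always_mem_of_unbox_proves hΓ.1 hφ ?_)
    exact hn.taut₁ fun V hV => by simp only [hV.neg]; tauto
  obtain ⟨Δ, hΔ, hsub⟩ := exists_saturatedSentences
    (Γ := insert (neg φ) (unbox d Γ)) (by
      rintro ψ (rfl | hψ)
      exacts [hφ, hψ.1]) hc ((closedComplete_unbox hΓ d).insert hφ)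
  exact ⟨Δ, hΔ, fun ψ hs hψ => hsub (.inr ⟨hs, hψ⟩), (hΔ.1.neg_mem hφ).1 (hsub (.inl rfl))⟩

theorem SaturatedSentences.exists_sees_mem (hΓ : SaturatedSentences Γ) {φ : Formula L}
    (h : sometime d φ ∈ Γ) : ∃ Δ, SaturatedSentences Δ ∧ Sees d Γ Δ ∧ φ ∈ Δ := by
  have hs : φ.IsSentence := by simpa using hΓ.1.1 _ h
  obtain ⟨Δ, hΔ, hsee, hn⟩ := hΓ.exists_sees_not_mem (φ := neg φ) hs
    ((hΓ.1.neg_mem (by simpa using hs)).1 h)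
  exact ⟨Δ, hΔ, hsee, by simpa [hΔ.1.neg_mem hs] using hn⟩

theorem SaturatedSentences.exists_sees (hΓ : SaturatedSentences Γ) (d : Bool) :
    ∃ Δ, SaturatedSentences Δ ∧ Sees d Γ Δ := by
  let χ : Formula L := all 0 verum
  have hχ : χ.IsSentence := by
    simp [χ, IsSentence, verum, freeVars, FirstOrder.Language.Term.varFinset]
  have h : always d χ ∈ Γ :=
    hΓ.1.mem_of_LR (by simpa using hχ) (LR_nec d (Derivable.genAll 0 verum_mem_LR))
  obtain ⟨Δ, hΔ, hsee, -⟩ := hΓ.exists_sees_mem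
    (hΓ.1.mp (by simpa using hχ) (LR_endless d χ) h)
  exact ⟨Δ, hΔ, hsee⟩

/-- Two saturated sets seen from a third in the same direction are comparable. If they were not,
three sentences would tell them apart in a way that contradicts the linearity axiom. -/
theorem Sees.comparable (hΓ : SaturatedSentences Γ) (hΔ : SaturatedSentences Δ)
    (hΘ : SaturatedSentences Θ) (h : Sees d Γ Δ) (h' : Sees d Γ Θ) :
    Δ = Θ ∨ Sees d Δ Θ ∨ Sees d Θ Δ := by
  by_contra! hcon
  obtain ⟨hne, h1, h2⟩ := hcon
  have h0 : ¬ Δ ⊆ Θ := fun hsub => hne (hΔ.1.eq_of_subset hΘ.1 hsub)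
  obtain ⟨φ, hφ, hφ'⟩ := Set.not_subset.1 h0
  simp only [Sees, not_forall] at h1 h2
  obtain ⟨ψ, hsψ, hψ, hψ'⟩ := h1
  obtain ⟨χ, hsχ, hχ, hχ'⟩ := h2
  have hsφ := hΔ.1.1 φ hφ
  let A := and φ (and (always d ψ) (neg χ))
  let B := and (neg φ) (and (neg ψ) (always d χ))
  have hA : A ∈ Δ := hΔ.1.and_mem.2 ⟨hφ, hΔ.1.and_mem.2 ⟨hψ, (hΔ.1.neg_mem hsχ).2 hχ'⟩⟩
  have hB : B ∈ Θ := hΘ.1.and_mem.2 ⟨(hΘ.1.neg_mem hsφ).2 hφ',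
    hΘ.1.and_mem.2 ⟨(hΘ.1.neg_mem hsψ).2 hψ', hχ⟩⟩
  have hsA := hΔ.1.1 A hA
  have hsB := hΘ.1.1 B hB
  -- No saturated set contains `A`, and sees a set containing `B`; and likewise with `A`, `B`
  -- exchanged.
  have hAB : ∀ Ξ, SaturatedSentences Ξ → A ∈ Ξ → sometime d B ∉ Ξ := by
    intro Ξ hΞ hmem hsome
    obtain ⟨Ξ', hΞ', hsee, hB'⟩ := hΞ.exists_sees_mem hsome
    have := hsee ψ hsψ (hΞ.1.and_mem.1 (hΞ.1.and_mem.1 hmem).2).1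
    exact (hΞ'.1.neg_mem hsψ).1 (hΞ'.1.and_mem.1 (hΞ'.1.and_mem.1 hB').2).1 this
  have hBA : ∀ Ξ, SaturatedSentences Ξ → B ∈ Ξ → sometime d A ∉ Ξ := by
    intro Ξ hΞ hmem hsome
    obtain ⟨Ξ', hΞ', hsee, hA'⟩ := hΞ.exists_sees_mem hsome
    have := hsee χ hsχ (hΞ.1.and_mem.1 (hΞ.1.and_mem.1 hmem).2).2
    exact (hΞ'.1.neg_mem hsχ).1 (hΞ'.1.and_mem.1 (hΞ'.1.and_mem.1 hA').2).2 this
  have hor := hΓ.1.mp (by simp [hsA, hsB]) (LR_linear d A B)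
    (hΓ.1.and_mem.2 ⟨h.sometime_mem hΓ.1 hΔ.1 hA, h'.sometime_mem hΓ.1 hΘ.1 hB⟩)
  rw [hΓ.1.or_mem (by simp [hsA, hsB]) (by simp [hsA, hsB]),
    hΓ.1.or_mem (by simp [hsA, hsB]) (by simp [hsA, hsB])] at hor
  rcases hor with (hor | hor) | hor
  · obtain ⟨Ξ, hΞ, -, hmem⟩ := hΓ.exists_sees_mem hor
    obtain ⟨hA', hB'⟩ := hΞ.1.and_mem.1 hmem
    exact (hΞ.1.neg_mem hsφ).1 (hΞ.1.and_mem.1 hB').1 (hΞ.1.and_mem.1 hA').1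
  · obtain ⟨Ξ, hΞ, -, hmem⟩ := hΓ.exists_sees_mem hor
    exact hAB Ξ hΞ (hΞ.1.and_mem.1 hmem).1 (hΞ.1.and_mem.1 hmem).2
  · obtain ⟨Ξ, hΞ, -, hmem⟩ := hΓ.exists_sees_mem hor
    exact hBA Ξ hΞ (hΞ.1.and_mem.1 hmem).2 (hΞ.1.and_mem.1 hmem).1

/-- The canonical frame is dense. If `Δ` sees itself, then `Δ` itself lies between. Otherwise some
`χ ∉ Δ` has `Hχ ∈ Δ`, so `Γ` contains `F(Hχ ∧ ¬χ)` and hence `FF(Hχ ∧ ¬χ)`; a set witnessing the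
outer `F` cannot be `Δ` or lie after `Δ`. -/
theorem Sees.exists_between (hΓ : SaturatedSentences Γ) (hΔ : SaturatedSentences Δ)
    (h : Sees d Γ Δ) : ∃ Θ, SaturatedSentences Θ ∧ Sees d Γ Θ ∧ Sees d Θ Δ := by
  by_cases hrefl : Sees (!d) Δ Δ
  · exact ⟨Δ, hΔ, h, by simpa using hrefl.symm hΔ.1 hΔ.1⟩
  simp only [Sees, not_forall] at hrefl
  obtain ⟨χ, hs, hχ, hn⟩ := hrefl
  let A := and (always (!d) χ) (neg χ)
  have hA : A ∈ Δ := hΔ.1.and_mem.2 ⟨hχ, (hΔ.1.neg_mem hs).2 hn⟩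
  have hsA := hΔ.1.1 A hA
  have hF : sometime d A ∈ Γ := h.sometime_mem hΓ.1 hΔ.1 hA
  have hFF : sometime d (sometime d A) ∈ Γ := by
    rw [sometime, hΓ.1.neg_mem (by simpa using hsA)] at hF ⊢
    refine fun hmem => hF (hΓ.1.mp (by simpa using hsA) (LR_dense d _) ?_)
    exact hΓ.1.always_mono (by simpa using hsA) (LR_taut fun V hV => by
      simp only [sometime, hV.imp, hV.neg]; tauto) hmem
  obtain ⟨Θ, hΘ, hsee, hmem⟩ := hΓ.exists_sees_mem hFF
  -- No set seen from `Δ` contains `A`.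
  have hnot : sometime d A ∉ Δ := by
    intro hmem
    obtain ⟨Ξ, hΞ, hsee, hA'⟩ := hΔ.exists_sees_mem hmem
    exact hn (hsee.symm hΔ.1 hΞ.1 χ hs (hΞ.1.and_mem.1 hA').1)
  refine ⟨Θ, hΘ, hsee, ?_⟩
  rcases hsee.comparable hΓ hΘ hΔ h with rfl | h' | h'
  · exact (hnot hmem).elim
  · exact h'
  · obtain ⟨Ξ, hΞ, hsee', hA'⟩ := hΘ.exists_sees_mem hmem
    exact (hnot ((h'.trans hΔ.1 hsee').sometime_mem hΔ.1 hΞ.1 hA')).elim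

end Canonical

/-! ### Rational chains in dense linear frames -/

section Chain

variable {Q W κ : Type*} [LinearOrder Q]

/-- A finite chain for the relation `R`, indexed by the members of `dom`. The values of `map`
outside `dom` carry no information. -/
structure FiniteChain (Q : Type*) [LinearOrder Q] {W : Type*} (R : W → W → Prop) where
  dom : Finset Q
  map : Q → W
  rel : ∀ a ∈ dom, ∀ b ∈ dom, a < b → R (map a) (map b)

namespace FiniteChain

variable {R : W → W → Prop}

/-- Extension of chains. -/
instance : Preorder (FiniteChain Q R) where
  le p p' := p.dom ⊆ p'.dom ∧ ∀ q ∈ p.dom, p.map q = p'.map q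
  le_refl p := ⟨subset_rfl, fun _ _ => rfl⟩
  le_trans p p' p'' h h' :=
    ⟨h.1.trans h'.1, fun q hq => (h.2 q hq).trans (h'.2 q (h.1 hq))⟩

/-- A point in the right position can be added to a chain. -/
theorem exists_insert (p : FiniteChain Q R) {q : Q} (hq : q ∉ p.dom) {w : W}
    (hlt : ∀ a ∈ p.dom, a < q → R (p.map a) w) (hgt : ∀ a ∈ p.dom, q < a → R w (p.map a)) :
    ∃ p', p ≤ p' ∧ q ∈ p'.dom ∧ p'.map q = w := by
  have hne : ∀ a ∈ p.dom, a ≠ q := fun a ha h => hq (h ▸ ha)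
  refine ⟨⟨insert q p.dom, Function.update p.map q w, ?_⟩,
    ⟨Finset.subset_insert _ _, fun a ha => by simp [hne a ha]⟩, Finset.mem_insert_self _ _,
    by simp⟩
  intro a ha b hb hab
  rcases Finset.mem_insert.1 ha with ha' | ha' <;> rcases Finset.mem_insert.1 hb with hb' | hb'
  · exact (hab.ne (ha'.trans hb'.symm)).elim
  · simpa [ha', hne b hb'] using hgt b hb' (ha' ▸ hab)
  · simpa [hb', hne a ha'] using hlt a ha' (hb' ▸ hab)
  · simpa [hne a ha', hne b hb'] using p.rel a ha' b hb' hab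

theorem exists_mem_dom [Nonempty W] (htrans : ∀ a b c, R a b → R b c → R a c)
    (hser : ∀ a, ∃ b, R a b) (hser' : ∀ a, ∃ b, R b a)
    (hdense : ∀ a b, R a b → ∃ c, R a c ∧ R c b) (p : FiniteChain Q R) (q : Q) :
    ∃ p', p ≤ p' ∧ q ∈ p'.dom := by
  by_cases hq : q ∈ p.dom
  · exact ⟨p, le_rfl, hq⟩
  suffices h : ∃ w, (∀ a ∈ p.dom, a < q → R (p.map a) w) ∧ ∀ a ∈ p.dom, q < a → R w (p.map a) by
    obtain ⟨w, h1, h2⟩ := h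
    obtain ⟨p', hle, hmem, -⟩ := p.exists_insert hq h1 h2
    exact ⟨p', hle, hmem⟩
  have hbelow : (∀ a ∈ p.dom, ¬ a < q) ∨
      ∃ m ∈ p.dom, m < q ∧ ∀ a ∈ p.dom, a < q → ∀ w, R (p.map m) w → R (p.map a) w := by
    by_cases h : (p.dom.filter (· < q)).Nonempty
    · have hm := Finset.mem_filter.1 (Finset.max'_mem _ h)
      refine .inr ⟨_, hm.1, hm.2, fun a ha haq w hw => ?_⟩
      have hmem : a ∈ p.dom.filter (· < q) := Finset.mem_filter.2 ⟨ha, haq⟩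
      rcases (Finset.le_max' _ a hmem).eq_or_lt with he | hlt
      · rwa [← he] at hw
      · exact htrans _ _ _ (p.rel a ha _ hm.1 hlt) hw
    · rw [Finset.not_nonempty_iff_eq_empty, Finset.filter_eq_empty_iff] at h
      exact .inl fun a ha => h ha
  have habove : (∀ a ∈ p.dom, ¬ q < a) ∨
      ∃ m ∈ p.dom, q < m ∧ ∀ a ∈ p.dom, q < a → ∀ w, R w (p.map m) → R w (p.map a) := by
    by_cases h : (p.dom.filter (q < ·)).Nonempty
    · have hm := Finset.mem_filter.1 (Finset.min'_mem _ h)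
      refine .inr ⟨_, hm.1, hm.2, fun a ha haq w hw => ?_⟩
      have hmem : a ∈ p.dom.filter (q < ·) := Finset.mem_filter.2 ⟨ha, haq⟩
      rcases (Finset.min'_le _ a hmem).eq_or_lt with he | hlt
      · rwa [he] at hw
      · exact htrans _ _ _ hw (p.rel _ hm.1 a ha hlt)
    · rw [Finset.not_nonempty_iff_eq_empty, Finset.filter_eq_empty_iff] at h
      exact .inl fun a ha => h ha
  rcases hbelow with hb | ⟨m, hm, hmq, hb⟩ <;> rcases habove with ha | ⟨n, hn, hqn, ha⟩
  · exact ⟨Classical.arbitrary W, fun a h h' => (hb a h h').elim, fun a h h' => (ha a h h').elim⟩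
  · obtain ⟨w, hw⟩ := hser' (p.map n)
    exact ⟨w, fun a h h' => (hb a h h').elim, fun a h h' => ha a h h' w hw⟩
  · obtain ⟨w, hw⟩ := hser (p.map m)
    exact ⟨w, fun a h h' => hb a h h' w hw, fun a h h' => (ha a h h').elim⟩
  · obtain ⟨w, hw, hw'⟩ := hdense _ _ (p.rel m hm n hn (hmq.trans hqn))
    exact ⟨w, fun a h h' => hb a h h' w hw, fun a h h' => ha a h h' w hw'⟩

variable [DenselyOrdered Q]

/-- If the point at `q` sees a point `w`, then `w` occurs later in the chain or fits in at some
later place: immediately after the last member that sees `w`. -/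
theorem exists_place [NoMaxOrder Q] (htrans : ∀ a b c, R a b → R b c → R a c)
    (hlin : ∀ a b c, R a b → R a c → b = c ∨ R b c ∨ R c b) (p : FiniteChain Q R) {q : Q}
    (hq : q ∈ p.dom) {w : W} (hw : R (p.map q) w) :
    ∃ q', q < q' ∧ ((q' ∈ p.dom ∧ p.map q' = w) ∨ (q' ∉ p.dom ∧
      (∀ a ∈ p.dom, a < q' → R (p.map a) w) ∧ ∀ a ∈ p.dom, q' < a → R w (p.map a))) := by
  classical
  let C := p.dom.filter fun a => R (p.map a) w
  have hqC : q ∈ C := Finset.mem_filter.2 ⟨hq, hw⟩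
  let m := C.max' ⟨q, hqC⟩
  have hm := Finset.mem_filter.1 (C.max'_mem ⟨q, hqC⟩)
  have hqm : q ≤ m := C.le_max' q hqC
  have hle : ∀ a ∈ p.dom, a ≤ m → R (p.map a) w := by
    intro a ha ham
    rcases ham.eq_or_lt with he | hlt
    · rw [he]; exact hm.2
    · exact htrans _ _ _ (p.rel a ha m hm.1 hlt) hm.2
  have hnot : ∀ a ∈ p.dom, m < a → ¬ R (p.map a) w := fun a ha hma hR =>
    (C.le_max' a (Finset.mem_filter.2 ⟨ha, hR⟩)).not_gt hma
  by_cases hA : (p.dom.filter (m < ·)).Nonempty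
  · let n := (p.dom.filter (m < ·)).min' hA
    have hn : n ∈ p.dom ∧ m < n := Finset.mem_filter.1 (Finset.min'_mem _ hA)
    have hnle : ∀ a ∈ p.dom, m < a → n ≤ a := fun a ha hma =>
      Finset.min'_le _ a (Finset.mem_filter.2 ⟨ha, hma⟩)
    rcases hlin _ _ _ (p.rel q hq n hn.1 (hqm.trans_lt hn.2)) hw with he | hR | hR
    · exact ⟨n, hqm.trans_lt hn.2, .inl ⟨hn.1, he⟩⟩
    · exact (hnot n hn.1 hn.2 hR).elim
    · obtain ⟨q', h1, h2⟩ := exists_between hn.2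
      refine ⟨q', hqm.trans_lt h1, .inr ⟨fun h => (hnle q' h h1).not_gt h2, fun a ha haq => ?_,
        fun a ha hqa => ?_⟩⟩
      · exact hle a ha (not_lt.1 fun hma => (hnle a ha hma).not_gt (haq.trans h2))
      · rcases (hnle a ha (h1.trans hqa)).eq_or_lt with he | hlt
        · rwa [← he]
        · exact htrans _ _ _ hR (p.rel n hn.1 a ha hlt)
  · rw [Finset.not_nonempty_iff_eq_empty, Finset.filter_eq_empty_iff] at hA
    obtain ⟨q', hq'⟩ := exists_gt m
    exact ⟨q', hqm.trans_lt hq', .inr ⟨fun h => hA h hq',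
      fun a ha _ => hle a ha (not_lt.1 (hA ha)), fun a ha hqa => (hA ha (hq'.trans hqa)).elim⟩⟩

/-- The mirror image of `exists_place`. -/
theorem exists_place_before [NoMinOrder Q] (htrans : ∀ a b c, R a b → R b c → R a c)
    (hlin : ∀ a b c, R b a → R c a → b = c ∨ R b c ∨ R c b) (p : FiniteChain Q R) {q : Q}
    (hq : q ∈ p.dom) {w : W} (hw : R w (p.map q)) :
    ∃ q', q' < q ∧ ((q' ∈ p.dom ∧ p.map q' = w) ∨ (q' ∉ p.dom ∧
      (∀ a ∈ p.dom, a < q' → R (p.map a) w) ∧ ∀ a ∈ p.dom, q' < a → R w (p.map a))) := by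
  let p' : FiniteChain Qᵒᵈ (fun a b => R b a) :=
    ⟨p.dom, p.map, fun a ha b hb hab => p.rel b hb a ha hab⟩
  obtain ⟨q', hlt, h⟩ := p'.exists_place (q := OrderDual.toDual q) (w := w)
    (fun a b c h h' => htrans c b a h' h)
    (fun a b c h h' => (hlin a b c h h').imp_right Or.symm) hq hw
  exact ⟨q', hlt, h.imp_right fun h => ⟨h.1, h.2.2, h.2.1⟩⟩

end FiniteChain

/-- In a transitive, dense, serial frame without branching, every point lies on a chain of the
order type of the rationals that realises each of countably many properties after (before) a
given member whenever some point after (before) that member has it. The chain is the union of a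
generic ideal of finite chains. -/
theorem exists_rat_chain [Countable κ] {R : W → W → Prop} (w₀ : W)
    (htrans : ∀ a b c, R a b → R b c → R a c)
    (hlin : ∀ a b c, R a b → R a c → b = c ∨ R b c ∨ R c b)
    (hlin' : ∀ a b c, R b a → R c a → b = c ∨ R b c ∨ R c b)
    (hser : ∀ a, ∃ b, R a b) (hser' : ∀ a, ∃ b, R b a)
    (hdense : ∀ a b, R a b → ∃ c, R a c ∧ R c b) (S : κ → Set W) :
    ∃ g : ℚ → W, g 0 = w₀ ∧ (∀ q q', q < q' → R (g q) (g q')) ∧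
      (∀ q k, (∃ w, R (g q) w ∧ w ∈ S k) → ∃ q', q < q' ∧ g q' ∈ S k) ∧
      ∀ q k, (∃ w, R w (g q) ∧ w ∈ S k) → ∃ q', q' < q ∧ g q' ∈ S k := by
  obtain ⟨_⟩ := nonempty_encodable κ
  have : Nonempty W := ⟨w₀⟩
  let after : ℚ × κ → Order.Cofinal (FiniteChain ℚ R) := fun i =>
    { carrier := {p | i.1 ∈ p.dom ∧ ((∃ w, R (p.map i.1) w ∧ w ∈ S i.2) →
        ∃ q', i.1 < q' ∧ q' ∈ p.dom ∧ p.map q' ∈ S i.2)}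
      isCofinal := by
        intro p
        obtain ⟨p₁, hle, hmem⟩ := p.exists_mem_dom htrans hser hser' hdense i.1
        by_cases h : ∃ w, R (p₁.map i.1) w ∧ w ∈ S i.2
        · obtain ⟨w, hw, hwS⟩ := h
          obtain ⟨q', hlt, ⟨hq', he⟩ | ⟨hq', h1, h2⟩⟩ :=
            p₁.exists_place htrans hlin hmem hw
          · exact ⟨p₁, ⟨hmem, fun _ => ⟨q', hlt, hq', by rwa [he]⟩⟩, hle⟩
          · obtain ⟨p₂, hle₂, hmem₂, he⟩ := p₁.exists_insert hq' h1 h2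
            exact ⟨p₂, ⟨hle₂.1 hmem, fun _ => ⟨q', hlt, hmem₂, by rwa [he]⟩⟩, hle.trans hle₂⟩
        · exact ⟨p₁, ⟨hmem, fun h' => (h h').elim⟩, hle⟩ }
  let before : ℚ × κ → Order.Cofinal (FiniteChain ℚ R) := fun i =>
    { carrier := {p | i.1 ∈ p.dom ∧ ((∃ w, R w (p.map i.1) ∧ w ∈ S i.2) →
        ∃ q', q' < i.1 ∧ q' ∈ p.dom ∧ p.map q' ∈ S i.2)}
      isCofinal := by
        intro p
        obtain ⟨p₁, hle, hmem⟩ := p.exists_mem_dom htrans hser hser' hdense i.1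
        by_cases h : ∃ w, R w (p₁.map i.1) ∧ w ∈ S i.2
        · obtain ⟨w, hw, hwS⟩ := h
          obtain ⟨q', hlt, ⟨hq', he⟩ | ⟨hq', h1, h2⟩⟩ :=
            p₁.exists_place_before htrans hlin' hmem hw
          · exact ⟨p₁, ⟨hmem, fun _ => ⟨q', hlt, hq', by rwa [he]⟩⟩, hle⟩
          · obtain ⟨p₂, hle₂, hmem₂, he⟩ := p₁.exists_insert hq' h1 h2
            exact ⟨p₂, ⟨hle₂.1 hmem, fun _ => ⟨q', hlt, hmem₂, by rwa [he]⟩⟩, hle.trans hle₂⟩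
        · exact ⟨p₁, ⟨hmem, fun h' => (h h').elim⟩, hle⟩ }
  let total : ℚ → Order.Cofinal (FiniteChain ℚ R) := fun q =>
    { carrier := {p | q ∈ p.dom}
      isCofinal := fun p =>
        let ⟨p', hle, hmem⟩ := p.exists_mem_dom htrans hser hser' hdense q
        ⟨p', hmem, hle⟩ }
  let p₀ : FiniteChain ℚ R := ⟨{0}, fun _ => w₀, by simp⟩
  let 𝒟 : ℚ ⊕ (ℚ × κ) ⊕ (ℚ × κ) → Order.Cofinal (FiniteChain ℚ R) :=
    Sum.elim total (Sum.elim after before)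
  let I := Order.idealOfCofinals p₀ 𝒟
  have hI : ∀ i, ∃ p, p ∈ 𝒟 i ∧ p ∈ I := Order.cofinal_meets_idealOfCofinals p₀ 𝒟
  choose c hc hcI using fun q : ℚ => hI (.inl q)
  have hcoh : ∀ p ∈ I, ∀ q ∈ p.dom, (c q).map q = p.map q := by
    intro p hp q hq
    obtain ⟨p', -, h1, h2⟩ := I.directed p hp (c q) (hcI q)
    rw [h1.2 q hq, h2.2 q (hc q)]
  refine ⟨fun q => (c q).map q, ?_, fun q q' hlt => ?_, fun q k hex => ?_, fun q k hex => ?_⟩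
  · exact hcoh p₀ (Order.mem_idealOfCofinals _ _) 0 (by simp [p₀])
  · obtain ⟨p, hp, h1, h2⟩ := I.directed (c q) (hcI q) (c q') (hcI q')
    simp only [h1.2 q (hc q), h2.2 q' (hc q')]
    exact p.rel q (h1.1 (hc q)) q' (h2.1 (hc q')) hlt
  · obtain ⟨p, ⟨hq, hp⟩, hpI⟩ := hI (.inr (.inl (q, k)))
    obtain ⟨q', hlt, hq', hS⟩ := hp (by rwa [← hcoh p hpI q hq])
    exact ⟨q', hlt, by simpa only [hcoh p hpI q' hq'] using hS⟩
  · obtain ⟨p, ⟨hq, hp⟩, hpI⟩ := hI (.inr (.inr (q, k)))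
    obtain ⟨q', hlt, hq', hS⟩ := hp (by rwa [← hcoh p hpI q hq])
    exact ⟨q', hlt, by simpa only [hcoh p hpI q' hq'] using hS⟩

end Chain

/-! ### Identity in maximal sets of sentences -/

theorem closedTerm_func {n : ℕ} {F : L.Functions n} {ts : Fin n → L.Term ℕ}
    (h : ∀ i, ClosedTerm (ts i)) : ClosedTerm (.func F ts) :=
  Finset.eq_empty_iff_forall_notMem.2 fun x hx =>
    let ⟨i, _, hi⟩ := Finset.mem_biUnion.1 hx
    (h i).not_mem x hi

namespace MaximalSentences

variable {Γ : Set (Formula L)} (hΓ : MaximalSentences (LR L) Γ)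
include hΓ

theorem eq_refl {a : L.Term ℕ} (ha : ClosedTerm a) : eq a a ∈ Γ :=
  hΓ.mem_of_LR (isSentence_eq ha ha) (Derivable.selfIdentity a)

theorem mem_of_atomRepl {a b : L.Term ℕ} {φ ψ : Formula L} (hψ : ψ.IsSentence)
    (hr : AtomRepl a b φ ψ) (h : eq a b ∈ Γ) (hφ : φ ∈ Γ) : ψ ∈ Γ :=
  hΓ.mem_of_proves hψ (((Proves.of_LR (Derivable.identicals a b φ ψ hr)).mp
    (Proves.of_mem h)).mp (Proves.of_mem hφ))

theorem eq_symm {a b : L.Term ℕ} (ha : ClosedTerm a) (hb : ClosedTerm b) (h : eq a b ∈ Γ) :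
    eq b a ∈ Γ :=
  hΓ.mem_of_atomRepl (isSentence_eq hb ha) (.eq a b a a .replace (.keep a)) h (hΓ.eq_refl ha)

theorem eq_trans {a b c : L.Term ℕ} (ha : ClosedTerm a) (hc : ClosedTerm c) (h : eq a b ∈ Γ)
    (h' : eq b c ∈ Γ) : eq a c ∈ Γ :=
  hΓ.mem_of_atomRepl (isSentence_eq ha hc) (.eq a a b c (.keep a) .replace) h' h

theorem eq_func {n : ℕ} (F : L.Functions n) {ts ts' : Fin n → L.Term ℕ}
    (hts : ∀ i, ClosedTerm (ts i)) (hts' : ∀ i, ClosedTerm (ts' i))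
    (h : ∀ i, eq (ts i) (ts' i) ∈ Γ) : eq (.func F ts) (.func F ts') ∈ Γ := by
  classical
  have key : ∀ s : Finset (Fin n),
      eq (.func F ts) (.func F fun i => if i ∈ s then ts' i else ts i) ∈ Γ := by
    intro s
    induction s using Finset.induction_on with
    | empty => simpa using hΓ.eq_refl (closedTerm_func hts)
    | insert j s hj ih =>
      refine hΓ.mem_of_atomRepl (isSentence_eq (closedTerm_func hts) (closedTerm_func fun i => ?_))
        (.eq _ _ _ _ (.keep _) (.func F _ _ fun i => ?_)) (h j) ih
      · split_ifs
        exacts [hts' i, hts i]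
      · by_cases hij : i = j
        · subst hij
          simpa [hj] using TermRepl.replace
        · simpa [hij] using TermRepl.keep _
  simpa using key Finset.univ

theorem rel_of_eq {n : ℕ} (R : L.Relations n) {ts ts' : Fin n → L.Term ℕ}
    (hts : ∀ i, ClosedTerm (ts i)) (hts' : ∀ i, ClosedTerm (ts' i))
    (h : ∀ i, eq (ts i) (ts' i) ∈ Γ) (hR : rel R ts ∈ Γ) : rel R ts' ∈ Γ := by
  classical
  have key : ∀ s : Finset (Fin n), rel R (fun i => if i ∈ s then ts' i else ts i) ∈ Γ := by
    intro s
    induction s using Finset.induction_on with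
    | empty => simpa using hR
    | insert j s hj ih =>
      refine hΓ.mem_of_atomRepl (isSentence_rel fun i => ?_)
        (.rel R _ _ fun i => ?_) (h j) ih
      · split_ifs
        exacts [hts' i, hts i]
      · by_cases hij : i = j
        · subst hij
          simpa [hj] using TermRepl.replace
        · simpa [hij] using TermRepl.keep _
  simpa using key Finset.univ

theorem always_eq_mem (d : Bool) {a b : L.Term ℕ} (ha : ClosedTerm a) (hb : ClosedTerm b)
    (h : eq a b ∈ Γ) : always d (eq a b) ∈ Γ := by
  have hs := isSentence_eq ha hb
  have := hΓ.mp (by simpa using hs) (Derivable.rigid a b) h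
  rw [box, hΓ.and_mem, hΓ.and_mem] at this
  cases d
  exacts [this.1, this.2.2]

end MaximalSentences

/-! ### The canonical standard model over the rationals -/

section CanonicalModel

/-- The type of closed terms. -/
abbrev ClosedTerms (L : FirstOrder.Language.{u, v}) := {τ : L.Term ℕ // ClosedTerm τ}

variable {U : Type w} (g : ℚ → Set (Formula L)) (rep : U → ClosedTerms L)
  (val : ClosedTerms L → U)

/-- The standard model in which the atomic facts at `q` are read off from `g q`. The map `val`
sends closed terms to their values, and `rep` chooses a term for each value. -/
def canonicalModel : Premodel L ℚ U where
  Adm := Set.univ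
  nonempty := Set.univ_nonempty
  compl_mem _ _ := trivial
  inter_mem _ _ _ _ := trivial
  boxLT_mem _ _ := trivial
  boxGT_mem _ _ := trivial
  funVal F a := val ⟨.func F fun i => (rep (a i)).1, closedTerm_func fun i => (rep (a i)).2⟩
  relVal R a := {q | rel R (fun i => (rep (a i)).1) ∈ g q}

theorem canonicalModel_isStandard : (canonicalModel g rep val).IsStandard := rfl

variable {g rep val} (hg : ∀ q, SaturatedSentences (g q))
  (hval : ∀ (q : ℚ) (a b : ClosedTerms L), val a = val b ↔ eq a.1 b.1 ∈ g q)
  (hrep : ∀ a, val (rep a) = a)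

include hg hval hrep in
theorem canonicalModel_termVal (σ : ℕ → ClosedTerms L) (t : L.Term ℕ) :
    (canonicalModel g rep val).termVal (fun x => val (σ x)) t =
      val ⟨t.subst fun x => (σ x).1, closedTerm_subst (fun x => (σ x).2) t⟩ := by
  induction t with
  | var x => rfl
  | func F ts ih =>
    simp only [Premodel.termVal, ih]
    refine (hval 0 _ _).2 ((hg 0).1.eq_func F (fun i => (rep _).2)
      (fun i => closedTerm_subst (fun x => (σ x).2) (ts i)) fun i => ?_)
    exact (hval 0 _ ⟨(ts i).subst fun x => (σ x).1, closedTerm_subst (fun x => (σ x).2) _⟩).1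
      (hrep _)

include hg hval hrep in
/-- The truth lemma for the canonical model. -/
theorem canonicalModel_truth (hsurj : ∀ a, ∃ τ, val τ = a)
    (hchain : ∀ q q', q < q' → Sees true (g q) (g q'))
    (hG : ∀ (q : ℚ) (φ : Formula L), φ.IsSentence → G φ ∉ g q → ∃ q', q < q' ∧ φ ∉ g q')
    (hH : ∀ (q : ℚ) (φ : Formula L), φ.IsSentence → H φ ∉ g q → ∃ q', q' < q ∧ φ ∉ g q')
    (φ : Formula L) (σ : ℕ → ClosedTerms L) (q : ℚ) :
    (canonicalModel g rep val).Sat q (fun x => val (σ x)) φ ↔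
      φ.msubst (fun x => (σ x).1) ∈ g q := by
  have hs : ∀ (σ : ℕ → ClosedTerms L) (φ : Formula L),
      (φ.msubst fun x => (σ x).1).IsSentence := fun σ φ => isSentence_msubst (fun x => (σ x).2) φ
  have hterm := canonicalModel_termVal hg hval hrep
  induction φ generalizing σ q with
  | eq a b =>
    simp only [Premodel.Sat, Premodel.truth, hterm]
    exact hval q _ _
  | rel R ts =>
    simp only [Premodel.Sat, Premodel.truth, hterm]
    have hcl : ∀ i, ClosedTerm ((ts i).subst fun x => (σ x).1) := fun i =>
      closedTerm_subst (fun x => (σ x).2) _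
    have heq : ∀ i, eq (rep (val ⟨(ts i).subst fun x => (σ x).1, hcl i⟩)).1
        ((ts i).subst fun x => (σ x).1) ∈ g q := fun i =>
      (hval q _ ⟨(ts i).subst fun x => (σ x).1, hcl i⟩).1 (hrep _)
    exact ⟨(hg q).1.rel_of_eq R (fun i => (rep _).2) hcl heq,
      (hg q).1.rel_of_eq R hcl (fun i => (rep _).2) fun i =>
        (hg q).1.eq_symm (rep _).2 (hcl i) (heq i)⟩
  | and φ ψ ih ih' => simp only [Premodel.sat_and, ih, ih', msubst, (hg q).1.and_mem]
  | neg φ ih => simp only [Premodel.sat_neg, ih, msubst, (hg q).1.neg_mem (hs σ φ)]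
  | G φ ih =>
    simp only [Premodel.sat_G, ih, msubst]
    constructor
    · intro h
      by_contra hn
      obtain ⟨q', hlt, hn'⟩ := hG q _ (hs σ φ) hn
      exact hn' (h q' hlt)
    · exact fun h q' hlt => hchain q q' hlt _ (hs σ φ) h
  | H φ ih =>
    simp only [Premodel.sat_H, ih, msubst]
    constructor
    · intro h
      by_contra hn
      obtain ⟨q', hlt, hn'⟩ := hH q _ (hs σ φ) hn
      exact hn' (h q' hlt)
    · exact fun h q' hlt => (hchain q' q hlt).symm (hg q').1 (hg q).1 _ (hs σ φ) h
  | all x φ ih =>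
    have hcl : ∀ y, ClosedTerm ((fun x => (σ x).1) y) := fun y => (σ y).2
    have hall := isSentence_all_msubst hcl x φ
    -- The instance of the quantified formula at a closed term.
    have hinst : ∀ τ : ClosedTerms L,
        (canonicalModel g rep val).Sat q (Function.update (fun y => val (σ y)) x (val τ)) φ ↔
        (φ.msubst (Function.update (fun x => (σ x).1) x (.var x))).subst x τ.1 ∈ g q := by
      intro τ
      rw [msubst_update_subst (isClosing_of_closed hcl)]
      have h1 : Function.update (fun y => val (σ y)) x (val τ) =
          fun y => val (Function.update σ x τ y) := by
        funext y
        by_cases hy : y = x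
        · subst hy; simp
        · simp [hy]
      have h2 : Function.update (fun x => (σ x).1) x τ.1 =
          fun y => (Function.update σ x τ y).1 := by
        funext y
        by_cases hy : y = x
        · subst hy; simp
        · simp [hy]
      rw [h1, h2]
      exact ih _ q
    rw [(canonicalModel_isStandard g rep val).sat_all, msubst]
    constructor
    · exact fun h => (hg q).2 _ x hall fun τ hτ => (hinst ⟨τ, hτ⟩).1 (h _)
    · intro h a
      obtain ⟨τ, rfl⟩ := hsurj a
      exact (hinst τ).2 ((hg q).1.mp (isSentence_subst hall τ.2) (LR_all_imp_subst x _ τ.2) h)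

end CanonicalModel

/-- A saturated set of sentences of a countable language is the theory at time `0` of a standard
model over the rationals that validates `L_ℝ` and in which every element is the value of a closed
term. -/
theorem exists_standard_model [Countable (Formula L)] [Countable (L.Term ℕ)]
    {Γ : Set (Formula L)} (hΓ : SaturatedSentences Γ) :
    ∃ (U : Type) (M : Premodel L ℚ U) (val : ClosedTerms L → U),
      M.IsStandard ∧ M.ValidatesLR ∧ (∀ a, ∃ τ, val τ = a) ∧
      (∀ (τ : ClosedTerms L) (f : ℕ → U), M.termVal f τ.1 = val τ) ∧
      ∀ φ : Formula L, φ.IsSentence → ∀ f : ℕ → U, M.Sat 0 f φ ↔ φ ∈ Γ := by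
  let W := {Δ : Set (Formula L) // SaturatedSentences Δ}
  have hsymm : ∀ {d : Bool} {a b : W}, Sees d a.1 b.1 → Sees (!d) b.1 a.1 :=
    fun {d a b} h => h.symm a.2.1 b.2.1
  obtain ⟨g', hg0, hchain, hafter, hbefore⟩ :=
    exists_rat_chain (W := W) (κ := Formula L) (R := fun a b => Sees true a.1 b.1) ⟨Γ, hΓ⟩
      (fun a b c h h' => h.trans a.2.1 h')
      (fun a b c h h' => (h.comparable a.2 b.2 c.2 h').imp_left Subtype.ext)
      (fun a b c h h' => by
        rcases (hsymm h).comparable a.2 b.2 c.2 (hsymm h') with h | h | h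
        · exact .inl (Subtype.ext h)
        · exact .inr (.inr (hsymm (a := b) (b := c) h))
        · exact .inr (.inl (hsymm (a := c) (b := b) h)))
      (fun a => let ⟨Δ, hΔ, h⟩ := a.2.exists_sees true; ⟨⟨Δ, hΔ⟩, h⟩)
      (fun a => let ⟨Δ, hΔ, h⟩ := a.2.exists_sees false
        ⟨⟨Δ, hΔ⟩, hsymm (a := a) (b := ⟨Δ, hΔ⟩) h⟩)
      (fun a b h => let ⟨Δ, hΔ, h1, h2⟩ := h.exists_between a.2 b.2; ⟨⟨Δ, hΔ⟩, h1, h2⟩)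
      (fun φ => {a | φ ∉ a.1})
  let g : ℚ → Set (Formula L) := fun q => (g' q).1
  have hg : ∀ q, SaturatedSentences (g q) := fun q => (g' q).2
  have hrigid : ∀ (q q' : ℚ) (a b : ClosedTerms L), eq a.1 b.1 ∈ g q → eq a.1 b.1 ∈ g q' := by
    intro q q' a b h
    rcases lt_trichotomy q q' with hlt | rfl | hlt
    · exact hchain q q' hlt _ (isSentence_eq a.2 b.2) ((hg q).1.always_eq_mem true a.2 b.2 h)
    · exact h
    · exact hsymm (hchain q' q hlt) _ (isSentence_eq a.2 b.2)
        ((hg q).1.always_eq_mem false a.2 b.2 h)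
  let S : Setoid (ClosedTerms L) :=
    { r := fun a b => eq a.1 b.1 ∈ g 0
      iseqv := ⟨fun a => (hg 0).1.eq_refl a.2, fun {a b} => (hg 0).1.eq_symm a.2 b.2,
        fun {a b c} => (hg 0).1.eq_trans a.2 c.2⟩ }
  let val : ClosedTerms L → Shrink.{0} (Quotient S) := fun τ => equivShrink _ (Quotient.mk S τ)
  have hval : ∀ (q : ℚ) (a b : ClosedTerms L), val a = val b ↔ eq a.1 b.1 ∈ g q := by
    intro q a b
    rw [(equivShrink _).injective.eq_iff, Quotient.eq]
    exact ⟨hrigid 0 q a b, hrigid q 0 a b⟩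
  have hsurj : Function.Surjective val := (equivShrink _).surjective.comp Quotient.mk_surjective
  let rep := Function.surjInv hsurj
  have hrep : ∀ a, val (rep a) = a := Function.surjInv_eq hsurj
  have htruth := canonicalModel_truth hg hval hrep hsurj hchain
    (fun q φ hφ h => by
      obtain ⟨Δ, hΔ, h1, h2⟩ := (hg q).exists_sees_not_mem (d := true) hφ h
      exact hafter q φ ⟨⟨Δ, hΔ⟩, h1, h2⟩)
    (fun q φ hφ h => by
      obtain ⟨Δ, hΔ, h1, h2⟩ := (hg q).exists_sees_not_mem (d := false) hφ h
      exact hbefore q φ ⟨⟨Δ, hΔ⟩, hsymm (a := g' q) (b := ⟨Δ, hΔ⟩) h1, h2⟩)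
  have hval_rep : ∀ f : ℕ → Shrink.{0} (Quotient S), (fun x => val (rep (f x))) = f := fun f =>
    funext fun x => hrep (f x)
  have hsent : ∀ φ : Formula L, φ.IsSentence → ∀ (q : ℚ) (f : ℕ → Shrink.{0} (Quotient S)),
      (canonicalModel g rep val).Sat q f φ ↔ φ ∈ g q := by
    intro φ hφ q f
    rw [← hval_rep f, htruth φ (fun x => rep (f x)) q, msubst_sentence hφ]
  refine ⟨_, canonicalModel g rep val, val, canonicalModel_isStandard g rep val,
    (canonicalModel_isStandard g rep val).validatesLR fun φ hφ hs q f =>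
      (hsent φ hs q f).2 ((hg q).1.mem_of_LR hs hφ), hsurj, fun τ f => ?_, fun φ hφ f => ?_⟩
  · rw [← hval_rep f, canonicalModel_termVal hg hval hrep]
    congr 2
    exact τ.2.subst_eq _
  · rw [hsent φ hφ, show g 0 = Γ from congrArg Subtype.val hg0]

/-! ### Countability -/

theorem countable_formula [Countable (L.Term ℕ)] [Countable (Σ n, L.Relations n)] :
    Countable (Formula L) := by
  let atoms : Set (Formula L) :=
    (Set.range fun p : L.Term ℕ × L.Term ℕ => eq p.1 p.2) ∪
      Set.range fun p : Σ R : (Σ n, L.Relations n), Fin R.1 → L.Term ℕ => rel p.1.2 p.2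
  -- The formulas built from atoms in at most `n` steps.
  let S : ℕ → Set (Formula L) := fun n => Nat.rec atoms (fun _ X => X ∪ (Set.image2 and X X ∪
    (neg '' X ∪ (Set.image2 all Set.univ X ∪ (G '' X ∪ H '' X))))) n
  have hmono : Monotone S := monotone_nat_of_le_succ fun n => Set.subset_union_left
  have hcount : ∀ n, (S n).Countable := by
    intro n
    induction n with
    | zero => exact (Set.countable_range _).union (Set.countable_range _)
    | succ n ih =>
      exact ih.union ((ih.image2 ih _).union ((ih.image _).union
        ((Set.countable_univ.image2 ih _).union ((ih.image _).union (ih.image _)))))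
  have hall : ∀ φ : Formula L, ∃ n, φ ∈ S n := by
    intro φ
    induction φ with
    | eq a b => exact ⟨0, .inl ⟨(a, b), rfl⟩⟩
    | rel R ts => exact ⟨0, .inr ⟨⟨⟨_, R⟩, ts⟩, rfl⟩⟩
    | and φ ψ ih ih' =>
      obtain ⟨n, hn⟩ := ih
      obtain ⟨m, hm⟩ := ih'
      exact ⟨max n m + 1, .inr (.inl ⟨φ, hmono (le_max_left n m) hn, ψ,
        hmono (le_max_right n m) hm, rfl⟩)⟩
    | neg φ ih =>
      obtain ⟨n, hn⟩ := ih
      exact ⟨n + 1, .inr (.inr (.inl ⟨φ, hn, rfl⟩))⟩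
    | all x φ ih =>
      obtain ⟨n, hn⟩ := ih
      exact ⟨n + 1, .inr (.inr (.inr (.inl ⟨x, trivial, φ, hn, rfl⟩)))⟩
    | G φ ih =>
      obtain ⟨n, hn⟩ := ih
      exact ⟨n + 1, .inr (.inr (.inr (.inr (.inl ⟨φ, hn, rfl⟩))))⟩
    | H φ ih =>
      obtain ⟨n, hn⟩ := ih
      exact ⟨n + 1, .inr (.inr (.inr (.inr (.inr ⟨φ, hn, rfl⟩))))⟩
  rw [← Set.countable_univ_iff]
  exact (Set.countable_iUnion hcount).mono fun φ _ => Set.mem_iUnion.2 (hall φ)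

/-! ### The signature with additional constants -/

/-- The function symbols of `L`, and a constant symbol for each natural number. -/
inductive ParamFunctions (L : FirstOrder.Language.{u, v}) : ℕ → Type u
  | old {n : ℕ} (F : L.Functions n) : ParamFunctions L n
  | param (c : ℕ) : ParamFunctions L 0

/-- The signature `L` with countably many new individual constants, the parameters. -/
abbrev withParams (L : FirstOrder.Language.{u, v}) : FirstOrder.Language.{u, v} :=
  ⟨ParamFunctions L, L.Relations⟩

/-- The `c`-th parameter, as a term. -/
def param (L : FirstOrder.Language.{u, v}) (c : ℕ) : (withParams L).Term ℕ :=
  .func (ParamFunctions.param c : (withParams L).Functions 0) Fin.elim0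

theorem closedTerm_param (c : ℕ) : ClosedTerm (param L c) := closedTerm_func fun i => i.elim0

instance [Countable (Σ n, L.Functions n)] : Countable (Σ n, (withParams L).Functions n) := by
  refine Function.Surjective.countable
    (f := fun a : (Σ n, L.Functions n) ⊕ ℕ => (Sum.elim
      (fun F => ⟨F.1, ParamFunctions.old F.2⟩) (fun c => ⟨0, ParamFunctions.param c⟩) a :
        Σ n, (withParams L).Functions n)) ?_
  rintro ⟨n, F | c⟩
  exacts [⟨.inl ⟨_, F⟩, rfl⟩, ⟨.inr c, rfl⟩]

/-- The inclusion of the terms of `L` into those of the extended signature. -/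
def embedTerm : L.Term ℕ → (withParams L).Term ℕ
  | .var x => .var x
  | .func F ts => .func (ParamFunctions.old F) fun i => embedTerm (ts i)

/-- The inclusion of the formulas of `L` into those of the extended signature. -/
def Formula.embed : Formula L → Formula (withParams L)
  | eq a b => eq (embedTerm a) (embedTerm b)
  | rel (n := n) R ts => rel (L := withParams L) (n := n) R fun i => embedTerm (ts i)
  | and φ ψ => and φ.embed ψ.embed
  | neg φ => neg φ.embed
  | all x φ => all x φ.embed
  | G φ => G φ.embed
  | H φ => H φ.embed

namespace Premodel

variable {T : Type*} [LinearOrder T] {U : Type*}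

/-- The reduct of a premodel that forgets the values of the parameters. -/
def reduct (N : Premodel (withParams L) T U) : Premodel L T U where
  Adm := N.Adm
  nonempty := N.nonempty
  compl_mem := N.compl_mem
  inter_mem := N.inter_mem
  boxLT_mem := N.boxLT_mem
  boxGT_mem := N.boxGT_mem
  funVal F a := N.funVal (ParamFunctions.old F) a
  relVal {n} R a := N.relVal (n := n) R a

theorem reduct_termVal (N : Premodel (withParams L) T U) (f : ℕ → U) (t : L.Term ℕ) :
    N.reduct.termVal f t = N.termVal f (embedTerm t) := by
  induction t with
  | var x => rfl
  | func F ts ih =>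
    simp only [termVal, ih]
    rfl

theorem reduct_truth (N : Premodel (withParams L) T U) (φ : Formula L) (f : ℕ → U) :
    N.reduct.truth φ f = N.truth φ.embed f := by
  induction φ generalizing f with
  | eq a b => simp only [truth, embed, reduct_termVal]
  | rel R ts =>
    simp only [truth, embed, reduct_termVal]
    rfl
  | and φ ψ ih ih' => simp only [truth, embed, ih, ih']
  | neg φ ih | G φ ih | H φ ih => simp only [truth, embed, ih]
  | all x φ ih =>
    simp only [truth, embed, ih]
    rfl

end Premodel

/-! ### Replacing parameters by variables -/

/-- A translation of the extended signature into a signature `B` that keeps the symbols of `L`,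
renames all variables injectively and replaces each parameter by a term in which no renamed
variable occurs. -/
structure ParamTranslation (L B : FirstOrder.Language.{u, v}) where
  old : ∀ {n : ℕ}, L.Functions n → B.Functions n
  rel : ∀ {n : ℕ}, L.Relations n → B.Relations n
  var : ℕ → ℕ
  injective : Function.Injective var
  param : ℕ → B.Term ℕ
  not_mem : ∀ c x, var x ∉ (param c).varFinset

namespace ParamTranslation

variable {B : FirstOrder.Language.{u, v}} (T : ParamTranslation L B)

/-- The action of a translation on function symbols. -/
def func : ∀ {n : ℕ}, ParamFunctions L n → (Fin n → B.Term ℕ) → B.Term ℕ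
  | _, .old F, ts => .func (T.old F) ts
  | _, .param c, _ => T.param c

/-- The action of a translation on terms. -/
def term : (withParams L).Term ℕ → B.Term ℕ
  | .var x => .var (T.var x)
  | .func F ts => T.func F fun i => term (ts i)

/-- The action of a translation on formulas. -/
def form : Formula (withParams L) → Formula B
  | .eq a b => .eq (T.term a) (T.term b)
  | .rel R ts => .rel (T.rel R) fun i => T.term (ts i)
  | .and φ ψ => .and (form φ) (form ψ)
  | .neg φ => .neg (form φ)
  | .all x φ => .all (T.var x) (form φ)
  | .G φ => .G (form φ)
  | .H φ => .H (form φ)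

theorem mem_varFinset_term {x : ℕ} {t : (withParams L).Term ℕ} :
    T.var x ∈ (T.term t).varFinset ↔ x ∈ t.varFinset := by
  induction t with
  | var y => simp [term, T.injective.eq_iff]
  | func F ts ih =>
    rcases F with F | c
    · simp [term, func, ih]
    · simp [term, func, T.not_mem c x]

theorem mem_freeVars_form {x : ℕ} {φ : Formula (withParams L)} :
    T.var x ∈ (T.form φ).freeVars ↔ x ∈ φ.freeVars := by
  induction φ with
  | eq a b => simp [form, freeVars, T.mem_varFinset_term]
  | rel R ts => simp [form, freeVars, T.mem_varFinset_term]
  | and φ ψ ih ih' => simp [form, freeVars, ih, ih']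
  | neg φ ih | G φ ih | H φ ih => simpa [form, freeVars] using ih
  | all y φ ih => simp [form, freeVars, ih, T.injective.eq_iff]

theorem term_substTerm (x : ℕ) (τ t : (withParams L).Term ℕ) :
    T.term (substTerm x τ t) = substTerm (T.var x) (T.term τ) (T.term t) := by
  induction t with
  | var y =>
    by_cases hy : y = x
    · subst hy; simp [term, substTerm]
    · simp [term, substTerm, hy, T.injective.eq_iff]
  | func F ts ih =>
    rcases F with F | c
    · simp only [substTerm, FirstOrder.Language.Term.subst, term, func] at ih ⊢
      simp only [ih]
    · change T.param c = (T.param c).subst _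
      refine ((subst_congr fun y hy => ?_).trans (subst_var _)).symm
      have : y ≠ T.var x := fun h => T.not_mem c x (h ▸ hy)
      simp [this]

theorem form_subst (x : ℕ) (τ : (withParams L).Term ℕ) (φ : Formula (withParams L)) :
    T.form (φ.subst x τ) = (T.form φ).subst (T.var x) (T.term τ) := by
  induction φ with
  | eq | rel => simp only [Formula.subst, form, term_substTerm]
  | and φ ψ ih ih' => simp only [Formula.subst, form, ih, ih']
  | neg φ ih | G φ ih | H φ ih => simp only [Formula.subst, form, ih]
  | all y φ ih =>
    by_cases hy : y = x
    · simp [Formula.subst, form, hy]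
    · simp [Formula.subst, form, hy, T.injective.eq_iff, ih]

theorem form_freeFor {x : ℕ} {τ : (withParams L).Term ℕ} {φ : Formula (withParams L)}
    (h : φ.FreeFor x τ) : (T.form φ).FreeFor (T.var x) (T.term τ) := by
  induction φ with
  | eq | rel => trivial
  | and φ ψ ih ih' => exact ⟨ih h.1, ih' h.2⟩
  | neg φ ih | G φ ih | H φ ih => exact ih h
  | all y φ ih =>
    rcases h with h | ⟨h, h'⟩
    · exact .inl fun hx => h ((T.mem_freeVars_form (φ := all y φ)).1 hx)
    · exact .inr ⟨fun hy => h (T.mem_varFinset_term.1 hy), ih h'⟩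

theorem termRepl {τ τ' t t' : (withParams L).Term ℕ} (h : TermRepl τ τ' t t') :
    TermRepl (T.term τ) (T.term τ') (T.term t) (T.term t') := by
  induction h with
  | keep t => exact .keep _
  | replace => exact .replace
  | func F ts ts' h ih =>
    rcases F with F | c
    · exact .func (T.old F) _ _ ih
    · exact .keep _

theorem atomRepl {τ τ' : (withParams L).Term ℕ} {φ φ' : Formula (withParams L)}
    (h : AtomRepl τ τ' φ φ') : AtomRepl (T.term τ) (T.term τ') (T.form φ) (T.form φ') := by
  cases h with
  | eq s s' t t' hs ht => exact .eq _ _ _ _ (T.termRepl hs) (T.termRepl ht)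
  | rel R ts ts' h => exact .rel _ _ _ fun i => T.termRepl (h i)

/-- Translations preserve theoremhood. -/
theorem form_mem_LR {φ : Formula (withParams L)} (h : φ ∈ LR (withParams L)) :
    T.form φ ∈ LR B := by
  have h' : Derivable {α | RationalAxiom α ∨ DedekindAxiom α} φ := h
  change Derivable {α | RationalAxiom α ∨ DedekindAxiom α} (T.form φ)
  clear h
  induction h' with
  | ax h =>
    refine .ax ?_
    rcases h with h | h
    · left
      cases h with
      | transG φ => exact .transG (T.form φ)
      | transH φ => exact .transH (T.form φ)
      | linearF φ ψ => exact .linearF (T.form φ) (T.form ψ)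
      | linearP φ ψ => exact .linearP (T.form φ) (T.form ψ)
      | endlessG φ => exact .endlessG (T.form φ)
      | endlessH φ => exact .endlessH (T.form φ)
      | denseG φ => exact .denseG (T.form φ)
      | denseH φ => exact .denseH (T.form φ)
    · right
      cases h with
      | dedekind φ => exact .dedekind (T.form φ)
  | modusPonens h₁ h₂ ih₁ ih₂ => exact .modusPonens ih₁ ih₂
  | genG h ih => exact .genG ih
  | genH h ih => exact .genH ih
  | genAll x h ih => exact .genAll (T.var x) ih
  | tautology h =>
    exact .tautology fun V hn ha => h (fun φ => V (T.form φ)) (fun α => hn _) fun α β => ha _ _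
  | instantiation x φ τ h =>
    have := Derivable.instantiation (Ax := {α | RationalAxiom α ∨ DedekindAxiom α}) (T.var x)
      (T.form φ) (T.term τ) (T.form_freeFor h)
    rwa [← T.form_subst] at this
  | distribution x φ ψ => exact .distribution (T.var x) (T.form φ) (T.form ψ)
  | vacuous x φ h => exact .vacuous (T.var x) (T.form φ) fun hx => h (T.mem_freeVars_form.1 hx)
  | selfIdentity τ => exact .selfIdentity (T.term τ)
  | identicals τ τ' φ φ' h => exact .identicals _ _ _ _ (T.atomRepl h)
  | rigid τ τ' => exact .rigid (T.term τ) (T.term τ')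
  | distG φ ψ => exact .distG (T.form φ) (T.form ψ)
  | distH φ ψ => exact .distH (T.form φ) (T.form ψ)
  | convGP φ => exact .convGP (T.form φ)
  | convHF φ => exact .convHF (T.form φ)

end ParamTranslation

/-- All variables of the formula, free or bound, are smaller than `N`. -/
def Formula.VarsBelow (N : ℕ) : Formula L → Prop
  | eq a b => (∀ x ∈ a.varFinset, x < N) ∧ ∀ x ∈ b.varFinset, x < N
  | rel _ ts => ∀ i, ∀ x ∈ (ts i).varFinset, x < N
  | and φ ψ => φ.VarsBelow N ∧ ψ.VarsBelow N
  | neg φ => φ.VarsBelow N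
  | all x φ => x < N ∧ φ.VarsBelow N
  | G φ => φ.VarsBelow N
  | H φ => φ.VarsBelow N

theorem Formula.VarsBelow.mono {N N' : ℕ} (hN : N ≤ N') {φ : Formula L} (h : φ.VarsBelow N) :
    φ.VarsBelow N' := by
  induction φ with
  | eq a b => exact ⟨fun x hx => (h.1 x hx).trans_le hN, fun x hx => (h.2 x hx).trans_le hN⟩
  | rel R ts => exact fun i x hx => (h i x hx).trans_le hN
  | and φ ψ ih ih' => exact ⟨ih h.1, ih' h.2⟩
  | neg φ ih | G φ ih | H φ ih => exact ih h
  | all y φ ih => exact ⟨h.1.trans_le hN, ih h.2⟩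

theorem exists_varsBelow (φ : Formula L) : ∃ N, φ.VarsBelow N := by
  have key : ∀ s : Finset ℕ, ∀ x ∈ s, x < s.sup id + 1 := fun s x hx =>
    Nat.lt_succ_of_le (Finset.le_sup (f := id) hx)
  induction φ with
  | eq a b =>
    refine ⟨(a.varFinset ∪ b.varFinset).sup id + 1, fun x hx => ?_, fun x hx => ?_⟩
    · exact key _ x (Finset.mem_union_left _ hx)
    · exact key _ x (Finset.mem_union_right _ hx)
  | rel R ts =>
    exact ⟨(Finset.univ.biUnion fun i => (ts i).varFinset).sup id + 1, fun i x hx =>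
      key _ x (Finset.mem_biUnion.2 ⟨i, Finset.mem_univ i, hx⟩)⟩
  | and φ ψ ih ih' =>
    obtain ⟨n, hn⟩ := ih
    obtain ⟨m, hm⟩ := ih'
    exact ⟨max n m, hn.mono (le_max_left n m), hm.mono (le_max_right n m)⟩
  | neg φ ih | G φ ih | H φ ih => exact ih
  | all y φ ih =>
    obtain ⟨n, hn⟩ := ih
    exact ⟨max n (y + 1), Nat.lt_of_succ_le (le_max_right n (y + 1)), hn.mono (le_max_left _ _)⟩

theorem Formula.VarsBelow.lt_of_mem {N : ℕ} {φ : Formula L} (h : φ.VarsBelow N) {x : ℕ}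
    (hx : x ∈ φ.freeVars) : x < N := by
  induction φ with
  | eq a b => exact (Finset.mem_union.1 hx).elim (h.1 x) (h.2 x)
  | rel R ts =>
    obtain ⟨i, -, hi⟩ := Finset.mem_biUnion.1 hx
    exact h i x hi
  | and φ ψ ih ih' => exact (Finset.mem_union.1 hx).elim (ih h.1) (ih' h.2)
  | neg φ ih | G φ ih | H φ ih => exact ih h hx
  | all y φ ih => exact ih h.2 (Finset.mem_erase.1 hx).2

/-- Replacing `x` by a fresh variable `y` and then `y` by `x` restores the formula. -/
theorem subst_fresh {N : ℕ} {φ : Formula L} (h : φ.VarsBelow N) (x : ℕ) {y : ℕ} (hy : N ≤ y) :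
    (φ.subst x (.var y)).FreeFor y (.var x) ∧ (φ.subst x (.var y)).subst y (.var x) = φ := by
  have key : ∀ t : L.Term ℕ, (∀ z ∈ t.varFinset, z < N) →
      substTerm y (.var x) (substTerm x (.var y) t) = t := by
    intro t ht
    rw [substTerm, substTerm, subst_subst]
    refine (subst_congr fun z hz => ?_).trans (subst_var t)
    by_cases hzx : z = x
    · subst hzx; simp
    · have : z ≠ y := ((ht z hz).trans_le hy).ne
      simp [hzx, this]
  induction φ with
  | eq a b => exact ⟨trivial, by simp only [Formula.subst, key a h.1, key b h.2]⟩
  | rel R ts => exact ⟨trivial, by simp only [Formula.subst, key _ (h _)]⟩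
  | and φ ψ ih ih' =>
    exact ⟨⟨(ih h.1).1, (ih' h.2).1⟩, by simp only [Formula.subst, (ih h.1).2, (ih' h.2).2]⟩
  | neg φ ih | G φ ih | H φ ih => exact ⟨(ih h).1, by simp only [Formula.subst, (ih h).2]⟩
  | all z φ ih =>
    have hfree : y ∉ φ.freeVars := fun hmem => (h.2.lt_of_mem hmem).not_ge hy
    have hzy : z ≠ y := (h.1.trans_le hy).ne
    by_cases hz : z = x
    · subst hz
      have hfree' : y ∉ (all z φ).freeVars := fun hmem => hfree (Finset.mem_erase.1 hmem).2
      rw [Formula.subst, if_pos rfl]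
      exact ⟨freeFor_of_not_free hfree' _, subst_of_not_free hfree' _⟩
    · rw [Formula.subst, if_neg hz]
      refine ⟨.inr ⟨by simpa using hz, (ih h.2).1⟩, ?_⟩
      rw [Formula.subst, if_neg hzy, (ih h.2).2]

/-- An injective map of variables that fixes those below `N` and avoids all odd numbers from
`N` on. -/
def shiftVar (N x : ℕ) : ℕ := if x < N then x else 2 * x

theorem shiftVar_of_lt {N x : ℕ} (h : x < N) : shiftVar N x = x := if_pos h

theorem shiftVar_injective (N : ℕ) : Function.Injective (shiftVar N) := by
  intro x y h
  simp only [shiftVar] at h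
  split_ifs at h <;> omega

theorem shiftVar_ne (N c x : ℕ) : shiftVar N x ≠ 2 * (c + N) + 1 := by
  simp only [shiftVar]
  split_ifs <;> omega

/-- The translation back to `L` that turns all parameters into variables. -/
def eliminate (L : FirstOrder.Language.{u, v}) (N : ℕ) : ParamTranslation L L where
  old := id
  rel := id
  var := shiftVar N
  injective := shiftVar_injective N
  param c := .var (2 * (c + N) + 1)
  not_mem c x := by simpa using shiftVar_ne N c x

theorem eliminate_embedTerm {N : ℕ} {t : L.Term ℕ} (h : ∀ x ∈ t.varFinset, x < N) :
    (eliminate L N).term (embedTerm t) = t := by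
  induction t with
  | var x => exact congrArg _ (shiftVar_of_lt (h x (by simp)))
  | func F ts ih =>
    change FirstOrder.Language.Term.func F _ = _
    congr 1
    funext i
    exact ih i fun x hx => h x (by simpa using ⟨i, hx⟩)

theorem eliminate_embed {N : ℕ} {φ : Formula L} (h : φ.VarsBelow N) :
    (eliminate L N).form φ.embed = φ := by
  induction φ with
  | eq a b =>
    simp only [embed, ParamTranslation.form, eliminate_embedTerm h.1, eliminate_embedTerm h.2]
  | rel R ts =>
    simp only [embed, ParamTranslation.form, eliminate_embedTerm (h _)]
    rfl
  | and φ ψ ih ih' => simp only [embed, ParamTranslation.form, ih h.1, ih' h.2]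
  | neg φ ih | G φ ih | H φ ih => simp only [embed, ParamTranslation.form, ih h]
  | all x φ ih =>
    simp only [embed, ParamTranslation.form, ih h.2]
    exact congrArg (all · φ) (shiftVar_of_lt h.1)

/-- The extended signature has no new theorems in the language `L`. -/
theorem mem_LR_of_embed {φ : Formula L} (h : φ.embed ∈ LR (withParams L)) : φ ∈ LR L := by
  obtain ⟨N, hN⟩ := exists_varsBelow φ
  rw [← eliminate_embed hN]
  exact (eliminate L N).form_mem_LR h

/-! ### Generalization on constants -/

/-- The parameter `c` does not occur in the term. -/
def AvoidsTerm (c : ℕ) : (withParams L).Term ℕ → Prop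
  | .var _ => True
  | .func (.old _) ts => ∀ i, AvoidsTerm c (ts i)
  | .func (.param d) _ => d ≠ c

/-- The parameter `c` does not occur in the formula. -/
def Formula.Avoids (c : ℕ) : Formula (withParams L) → Prop
  | eq a b => AvoidsTerm c a ∧ AvoidsTerm c b
  | rel _ ts => ∀ i, AvoidsTerm c (ts i)
  | and φ ψ => φ.Avoids c ∧ ψ.Avoids c
  | neg φ => φ.Avoids c
  | all _ φ => φ.Avoids c
  | G φ => φ.Avoids c
  | H φ => φ.Avoids c

theorem avoidsTerm_embedTerm (c : ℕ) (t : L.Term ℕ) : AvoidsTerm c (embedTerm t) := by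
  induction t with
  | var x => trivial
  | func F ts ih => exact ih

theorem avoids_embed (c : ℕ) (φ : Formula L) : φ.embed.Avoids c := by
  induction φ with
  | eq a b => exact ⟨avoidsTerm_embedTerm c a, avoidsTerm_embedTerm c b⟩
  | rel R ts => exact fun i => avoidsTerm_embedTerm c (ts i)
  | and φ ψ ih ih' => exact ⟨ih, ih'⟩
  | neg φ ih | G φ ih | H φ ih | all x φ ih => exact ih

theorem avoidsTerm_subst {c : ℕ} {σ : ℕ → (withParams L).Term ℕ} (hσ : ∀ x, AvoidsTerm c (σ x))
    {t : (withParams L).Term ℕ} (h : AvoidsTerm c t) : AvoidsTerm c (t.subst σ) := by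
  induction t with
  | var x => exact hσ x
  | func F ts ih =>
    rcases F with F | d
    · exact fun i => ih i (h i)
    · exact h

theorem avoids_msubst {c : ℕ} {σ : ℕ → (withParams L).Term ℕ} (hσ : ∀ x, AvoidsTerm c (σ x))
    {φ : Formula (withParams L)} (h : φ.Avoids c) : (φ.msubst σ).Avoids c := by
  induction φ generalizing σ with
  | eq a b => exact ⟨avoidsTerm_subst hσ h.1, avoidsTerm_subst hσ h.2⟩
  | rel R ts => exact fun i => avoidsTerm_subst hσ (h i)
  | and φ ψ ih ih' => exact ⟨ih hσ h.1, ih' hσ h.2⟩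
  | neg φ ih | G φ ih | H φ ih => exact ih hσ h
  | all x φ ih =>
    refine ih (fun y => ?_) h
    by_cases hy : y = x
    · subst hy; rw [Function.update_self]; trivial
    · simpa [hy] using hσ y

theorem exists_avoidsTerm (t : (withParams L).Term ℕ) : ∃ N, ∀ c, N ≤ c → AvoidsTerm c t := by
  induction t with
  | var x => exact ⟨0, fun _ _ => trivial⟩
  | func F ts ih =>
    rcases F with F | d
    · choose N hN using ih
      exact ⟨Finset.univ.sup N, fun c hc i =>
        hN i c ((Finset.le_sup (Finset.mem_univ i)).trans hc)⟩
    · exact ⟨d + 1, fun c hc => (Nat.lt_of_succ_le hc).ne⟩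

theorem exists_avoids (φ : Formula (withParams L)) : ∃ N, ∀ c, N ≤ c → φ.Avoids c := by
  induction φ with
  | eq a b =>
    obtain ⟨n, hn⟩ := exists_avoidsTerm a
    obtain ⟨m, hm⟩ := exists_avoidsTerm b
    exact ⟨max n m, fun c hc => ⟨hn c (le_of_max_le_left hc), hm c (le_of_max_le_right hc)⟩⟩
  | rel R ts =>
    choose N hN using fun i => exists_avoidsTerm (ts i)
    exact ⟨Finset.univ.sup N, fun c hc i =>
      hN i c ((Finset.le_sup (Finset.mem_univ i)).trans hc)⟩
  | and φ ψ ih ih' =>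
    obtain ⟨n, hn⟩ := ih
    obtain ⟨m, hm⟩ := ih'
    exact ⟨max n m, fun c hc => ⟨hn c (le_of_max_le_left hc), hm c (le_of_max_le_right hc)⟩⟩
  | neg φ ih | G φ ih | H φ ih | all x φ ih => exact ih

/-- The translation that turns the parameter `c` into a fresh variable. -/
def release (L : FirstOrder.Language.{u, v}) (N c : ℕ) : ParamTranslation L (withParams L) where
  old := ParamFunctions.old
  rel := id
  var := shiftVar N
  injective := shiftVar_injective N
  param d := if d = c then .var (2 * (0 + N) + 1) else param L d
  not_mem d x := by
    split_ifs
    · simpa using shiftVar_ne N 0 x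
    · exact (closedTerm_param d).not_mem _

theorem release_term {N c : ℕ} {t : (withParams L).Term ℕ} (h : ∀ x ∈ t.varFinset, x < N)
    (hc : AvoidsTerm c t) : (release L N c).term t = t := by
  induction t with
  | var x => exact congrArg _ (shiftVar_of_lt (h x (by simp)))
  | func F ts ih =>
    rcases F with F | d
    · change FirstOrder.Language.Term.func (L := withParams L) (ParamFunctions.old F) _ = _
      congr 1
      funext i
      exact ih i (fun x hx => h x (by simpa using ⟨i, hx⟩)) (hc i)
    · have hd : d ≠ c := hc
      change (if d = c then _ else param L d) = _
      rw [if_neg hd, param]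
      congr 1
      exact funext fun i => i.elim0

theorem release_form {N c : ℕ} {φ : Formula (withParams L)} (h : φ.VarsBelow N)
    (hc : φ.Avoids c) : (release L N c).form φ = φ := by
  induction φ with
  | eq a b =>
    simp only [ParamTranslation.form, release_term h.1 hc.1, release_term h.2 hc.2]
  | rel R ts =>
    simp only [ParamTranslation.form, release_term (h _) (hc _)]
    rfl
  | and φ ψ ih ih' => simp only [ParamTranslation.form, ih h.1 hc.1, ih' h.2 hc.2]
  | neg φ ih | G φ ih | H φ ih => simp only [ParamTranslation.form, ih h hc]
  | all x φ ih =>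
    simp only [ParamTranslation.form, ih h.2 hc]
    exact congrArg (all · φ) (shiftVar_of_lt h.1)

/-- Generalization on constants: what is provable of a fresh parameter is provable of all
individuals. -/
theorem LR_all_of_param {x c : ℕ} {χ : Formula (withParams L)} (hc : χ.Avoids c)
    (h : χ.subst x (param L c) ∈ LR (withParams L)) : all x χ ∈ LR (withParams L) := by
  obtain ⟨N₀, hN₀⟩ := exists_varsBelow χ
  let N := max N₀ (x + 1)
  have hN : χ.VarsBelow N := hN₀.mono (le_max_left _ _)
  have hx : x < N := Nat.lt_of_succ_le (le_max_right _ _)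
  have hy : N ≤ 2 * (0 + N) + 1 := by omega
  have h1 := (release L N c).form_mem_LR h
  have hterm : (release L N c).term (param L c) = .var (2 * (0 + N) + 1) := by
    change (if c = c then _ else param L c) = _
    rw [if_pos rfl]
  rw [ParamTranslation.form_subst, release_form hN hc, hterm,
    show (release L N c).var x = x from shiftVar_of_lt hx] at h1
  obtain ⟨hfree, hback⟩ := subst_fresh hN x hy
  have h2 := Derivable.instantiation (Ax := {α | RationalAxiom α ∨ DedekindAxiom α}) _ _ _ hfree
  rw [hback] at h2
  exact Derivable.genAll x (LR_mp h2 (Derivable.genAll _ h1))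

/-! ### Naming the free variables by parameters -/

/-- The sentence obtained from a formula of `L` by replacing each free variable `x` by the
parameter `2x`. The odd parameters are left over as witnesses. -/
def Formula.close (φ : Formula L) : Formula (withParams L) :=
  φ.embed.msubst fun x => param L (2 * x)

theorem isSentence_close (φ : Formula L) : φ.close.IsSentence :=
  isSentence_msubst (fun x => closedTerm_param (2 * x)) φ.embed

theorem close_avoids (φ : Formula L) (n : ℕ) : φ.close.Avoids (2 * n + 1) :=
  avoids_msubst (fun x => by
    change 2 * x ≠ 2 * n + 1
    omega) (avoids_embed _ φ)

theorem mem_LR_of_close {φ : Formula L} (h : φ.close ∈ LR (withParams L)) : φ ∈ LR L := by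
  refine mem_LR_of_embed ?_
  -- The parameters are replaced by the variables they stand for, one at a time.
  let σ : ℕ → ℕ → (withParams L).Term ℕ := fun k x => if x < k then param L (2 * x) else .var x
  have hσ : ∀ k, IsClosing (σ k) := by
    intro k x
    by_cases hx : x < k
    · exact .inr (by simpa [σ, hx] using closedTerm_param (2 * x))
    · exact .inl (by simp [σ, hx])
  have key : ∀ k, φ.embed.msubst (σ k) ∈ LR (withParams L) → φ.embed ∈ LR (withParams L) := by
    intro k
    induction k with
    | zero =>
      intro h
      have : σ 0 = .var := funext fun x => by simp [σ]
      rwa [this, msubst_var] at h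
    | succ k ih =>
      intro h
      have hupd : σ (k + 1) = Function.update (σ k) k (param L (2 * k)) := by
        funext x
        by_cases hx : x = k
        · subst hx; simp [σ]
        · have : x < k + 1 ↔ x < k := by omega
          simp [σ, hx, this]
      rw [hupd, ← subst_msubst (hσ k) (by simp [σ])] at h
      refine ih (LR_inst (LR_all_of_param (avoids_msubst (fun x => ?_) (avoids_embed _ φ)) h))
      by_cases hx : x < k
      · simp only [σ, if_pos hx]
        exact show 2 * x ≠ 2 * k by omega
      · simp only [σ, if_neg hx]
        trivial
  obtain ⟨N, hN⟩ := exists_varsBelow φ.embed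
  refine key N ?_
  rwa [msubst_congr (σ' := fun x => param L (2 * x)) fun x hx => by
    simp [σ, hN.lt_of_mem hx]]

theorem consistent_close {Δ : Set (Formula L)} (h : Consistent (LR L) Δ) :
    Consistent (LR (withParams L)) (close '' Δ) := by
  intro l hl hn
  obtain ⟨l₀, hl₀, rfl⟩ : ∃ l₀ : List (Formula L), (∀ φ ∈ l₀, φ ∈ Δ) ∧ l₀.map close = l := by
    clear hn
    induction l with
    | nil => exact ⟨[], by simp, rfl⟩
    | cons a l ih =>
      obtain ⟨φ, hφ, rfl⟩ := hl a (by simp)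
      obtain ⟨l₀, hl₀, rfl⟩ := ih fun ψ hψ => hl ψ (by simp [hψ])
      exact ⟨φ :: l₀, by simpa using ⟨hφ, hl₀⟩, rfl⟩
  refine h l₀ hl₀ (mem_LR_of_close (φ := neg (conj l₀)) ?_)
  have key : ∀ V : Formula (withParams L) → Prop, IsValuation V → ∀ l : List (Formula L),
      V (conj l).close → ∀ φ ∈ l.map close, V φ := by
    intro V hV l
    induction l with
    | nil => simp
    | cons a l ih =>
      intro h
      have h' := hV.and.1 h
      simpa using ⟨h'.1, by simpa using ih h'.2⟩
  refine LR_taut₂ hn verum_mem_LR fun V hV h1 h2 => ?_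
  change V (neg (conj l₀).close)
  rw [hV.neg, hV.conj] at *
  exact fun h3 => h1 ⟨key V hV l₀ h3, h2⟩

/-- A conjunction of sentences that, unlike `conj`, is itself a sentence. -/
def sentenceConj (l : List (Formula L)) : Formula L := l.foldr and (all 0 verum)

theorem isSentence_sentenceConj {l : List (Formula L)} (h : ∀ φ ∈ l, φ.IsSentence) :
    (sentenceConj l).IsSentence := by
  induction l with
  | nil =>
    simp [sentenceConj, IsSentence, verum, freeVars, FirstOrder.Language.Term.varFinset]
  | cons a l ih =>
    exact isSentence_and.2 ⟨h a (by simp), ih fun φ hφ => h φ (by simp [hφ])⟩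

theorem avoids_sentenceConj {c : ℕ} {l : List (Formula (withParams L))}
    (h : ∀ φ ∈ l, φ.Avoids c) : (sentenceConj l).Avoids c := by
  induction l with
  | nil => exact ⟨trivial, trivial⟩
  | cons a l ih => exact ⟨h a (by simp), ih fun φ hφ => h φ (by simp [hφ])⟩

theorem IsValuation.of_sentenceConj {V : Formula L → Prop} (hV : IsValuation V)
    {l : List (Formula L)} (h : V (sentenceConj l)) : ∀ φ ∈ l, V φ := by
  induction l with
  | nil => simp
  | cons a l ih =>
    have h' := hV.and.1 h
    simpa using ⟨h'.1, ih h'.2⟩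

theorem closedComplete_close (Δ : Set (Formula L)) : ClosedComplete (close '' Δ) := by
  intro φ x hs hτ
  obtain ⟨N, hN⟩ := exists_avoids φ
  let c := 2 * N + 1
  obtain ⟨l, hl, h⟩ := hτ (param L c) (closedTerm_param c)
  have hlα : ∀ ψ ∈ l, ψ.IsSentence ∧ ψ.Avoids c := by
    intro ψ hψ
    obtain ⟨δ, -, rfl⟩ := hl ψ hψ
    exact ⟨isSentence_close δ, close_avoids δ N⟩
  have hx := not_mem_freeVars_of_sentence
    (isSentence_sentenceConj fun ψ hψ => (hlα ψ hψ).1) x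
  have h' : (imp (sentenceConj l) φ).subst x (param L c) ∈ LR (withParams L) := by
    change imp ((sentenceConj l).subst x (param L c)) (φ.subst x (param L c)) ∈ _
    rw [subst_of_not_free hx]
    refine LR_taut₂ h verum_mem_LR fun V hV => ?_
    rw [hV.imp, hV.imp, hV.conj]
    exact fun h1 h2 h3 => h1 ⟨hV.of_sentenceConj h3, h2⟩
  have hall := LR_mp (LR_all_imp hx φ) (LR_all_of_param
    (⟨avoids_sentenceConj fun ψ hψ => (hlα ψ hψ).2, hN c (by omega)⟩ :
      (imp (sentenceConj l) φ).Avoids c) h')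
  refine (Proves.of_LR hall).mp (Proves.taut (all 0 verum :: l) ?_ fun V hV hl => ?_)
  · simp only [List.forall_mem_cons]
    exact ⟨Proves.of_LR (Derivable.genAll 0 verum_mem_LR), fun ψ hψ => Proves.of_mem (hl ψ hψ)⟩
  · simp only [List.forall_mem_cons] at hl
    obtain ⟨h0, hl⟩ := hl
    clear h h' hall hx hlα
    induction l with
    | nil => exact h0
    | cons a l ih =>
      simp only [List.forall_mem_cons] at *
      exact hV.and.2 ⟨hl.1, ih (by tauto) hl.2⟩

/-! ### Strong completeness -/

/-- Every consistent set of formulas of a countable language is satisfiable in an admissible model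
over the reals. -/
theorem strong_completeness [Countable (Σ n, L.Functions n)] [Countable (Σ n, L.Relations n)]
    {Δ : Set (Formula L)} (hΔ : Consistent (LR L) Δ) :
    ∃ (U : Type) (M : Premodel L ℝ U), M.IsModel ∧
      ∃ (t : ℝ) (f : ℕ → U), ∀ φ ∈ Δ, M.Sat t f φ := by
  have : Countable (Formula (withParams L)) := countable_formula
  obtain ⟨Γ, hΓ, hsub⟩ := exists_saturatedSentences
    (by rintro _ ⟨φ, -, rfl⟩; exact isSentence_close φ) (consistent_close hΔ)
    (closedComplete_close Δ)
  obtain ⟨U, M, val, hstd, hM, hsurj, hterm, hsat⟩ := exists_standard_model hΓ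
  let par : ℕ → ClosedTerms (withParams L) := fun c => ⟨param L c, closedTerm_param c⟩
  have : Nonempty U := ⟨val (par 0)⟩
  choose name hname using hsurj
  obtain ⟨D, hD⟩ := exists_isRealExtension hM
  obtain ⟨-, N, -, -, hN, -, hNM⟩ := real_completion (name := fun a => (name a).1) hM hstd
    (fun a => ⟨(name a).2, fun f => by rw [hterm, hname]⟩) hD
  let f : ℕ → U := fun x => val (par (2 * x))
  refine ⟨U, N.reduct, fun φ f => ?_, ((0 : ℚ) : ℝ), f, fun φ hφ => ?_⟩
  · rw [N.reduct_truth]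
    exact hN φ.embed f
  · rw [Premodel.Sat, N.reduct_truth]
    refine (hNM φ.embed 0 f).2 ?_
    have h := (hsat φ.close (isSentence_close φ) f).2 (hsub ⟨φ, hφ, rfl⟩)
    rw [Premodel.Sat, close, M.truth_msubst
      (isClosing_of_closed fun x => closedTerm_param (2 * x))] at h
    have hf : (fun x => M.termVal f (param L (2 * x))) = f := funext fun x => hterm (par (2 * x)) f
    rwa [hf] at h

end TemporalLogic

theorem mainTheorem1 (L : FirstOrder.Language.{u, v})
    [Countable (Σ n, L.Functions n)] [Countable (Σ n, L.Relations n)] :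
    -- strong completeness
    (∀ Δ : Set (TemporalLogic.Formula L),
      TemporalLogic.Consistent (TemporalLogic.LR L) Δ →
      ∃ (U : Type) (M : TemporalLogic.Premodel L ℝ U), M.IsModel ∧
        ∃ (t : ℝ) (f : ℕ → U), ∀ φ ∈ Δ, M.Sat t f φ) ∧
    -- extension of a rational standard model to a real admissible model
    (∀ (Δ : Set (TemporalLogic.Formula L)) (U : Type w) (M : TemporalLogic.Premodel L ℚ U)
      (q₀ : ℚ) (f₀ : ℕ → U) (name : U → L.Term ℕ),
      TemporalLogic.Saturated (TemporalLogic.LR L) Δ →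
      M.IsStandard →
      (∀ φ ∈ Δ, M.Sat q₀ f₀ φ) →
      (∀ a : U, TemporalLogic.ClosedTerm (name a) ∧ ∀ f : ℕ → U, M.termVal f (name a) = a) →
      (∃ D : ℝ → Set (TemporalLogic.Formula L), TemporalLogic.IsRealExtension M D) ∧
      ∀ D : ℝ → Set (TemporalLogic.Formula L), TemporalLogic.IsRealExtension M D →
        (∀ r : ℝ, TemporalLogic.MaximalSentences (TemporalLogic.LR L) (D r)) ∧
        ∃ N : TemporalLogic.Premodel L ℝ U,
          TemporalLogic.IsRealCompletion M name D N ∧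
          (∀ φ : TemporalLogic.Formula L, φ.IsSentence →
            ∀ f : ℕ → U, N.truth φ f = {r : ℝ | φ ∈ D r}) ∧
          N.IsModel ∧
          (∀ φ : TemporalLogic.Formula L, φ.IsSentence →
            ∀ q : ℚ, N.TrueAt (q : ℝ) φ ↔ M.TrueAt q φ) ∧
          (∀ (φ : TemporalLogic.Formula L) (q : ℚ) (f : ℕ → U),
            N.Sat (q : ℝ) f φ ↔ M.Sat q f φ)) := by
  refine ⟨fun Δ hΔ => TemporalLogic.strong_completeness hΔ, ?_⟩
  intro Δ U M q₀ f₀ name hΔ hstd hsat hname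
  have : Nonempty U := ⟨f₀ 0⟩
  have hM : M.ValidatesLR := hstd.validatesLR_of_sat fun φ hφ => hsat φ (hΔ.1.LR_subset hφ)
  exact ⟨TemporalLogic.exists_isRealExtension hM,
    fun D hD => TemporalLogic.real_completion hM hstd hname hD⟩
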